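/- Let $(\mathcal H,(\cdot,\cdot))$ be a complex Hilbert space, let $G$ be a bounded selfadjoint operator on $\mathcal H$, and put $[x,y]:=(Gx,y)$. Let $A$ be a closed, densely defined operator in $\mathcal H$ that is $G$-symmetric, i.e. $[Ax,y]=[x,Ay]$ for all $x,y\in\operatorname{dom}A$. Let $\sigma_{ap}(A)$ be the set of all $\lambda\in\mathbb C$ for which there is a sequence $(x_n)$ in $\operatorname{dom}A$ with $\|x_n\|=1$ for all $n$ and $(A-\lambda)x_n\to0$. Let $\sigma_{\pi_+}(A)$ (respectively $\sigma_{\pi_-}(A)$) be the set of all $\lambda\in\sigma_{ap}(A)$ for which there is a linear manifold $\mathcal H_\lambda\subset\mathcal H$ with $\dim(\mathcal H/\mathcal H_\lambda)<\infty$ such that every sequence $(x_n)$ in $\mathcal H_\lambda\cap\operatorname{dom}A$ with $\|x_n\|=1$ for all $n$ and $(A-\lambda)x_n\to0$ satisfies $\liminf_{n\to\infty}[x_n,x_n]>0$ (respectively $\limsup_{n\to\infty}[x_n,x_n]<0$). Let $\rho(A)$ be the resolvent set of $A$. Let $a\le b$ be real numbers such that $[a,b]\cap\sigma_{ap}(A)\subset\sigma_{\pi_+}(A)$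 or $[a,b]\cap\sigma_{ap}(A)\subset\sigma_{\pi_-}(A)$, and suppose that there is an open neighborhood $\mathcal U$ of $[a,b]$ in $\mathbb C$ with $\mathcal U\setminus\mathbb R\subset\rho(A)$. Then there are an open neighborhood $\mathcal V$ of $[a,b]$ in $\mathbb C$ and constants $M>0$ and $m\in\mathbb N=\{0,1,2,\dots\}$ such that, for every $\lambda\in\mathcal V\setminus\mathbb R$, $\lambda\in\rho(A)$ and $$\|(A-\lambda)^{-1}\|\le\frac{M}{|\operatorname{Im}\lambda|^m}.$$ -/

import Mathlib

namespace IndefSpec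

variable {H : Type*} [NormedAddCommGroup H] [InnerProductSpace ℂ H]

/-- The indefinite inner product `[x, y] = (G x, y)` with Gram operator `G`. It is linear in `x` and
conjugate linear in `y`; Mathlib's `inner` is conjugate linear in its first argument, hence the
order of the arguments on the right. -/
noncomputable def gram (G : H →L[ℂ] H) (x y : H) : ℂ := inner ℂ y (G x)

/-- `A` is `G`-symmetric: `[A x, y] = [x, A y]` for all `x, y` in the domain of `A`. -/
def GSymmetric (G : H →L[ℂ] H) (A : H →ₗ.[ℂ] H) : Prop :=
  ∀ x y : A.domain, gram G (A x) (y : H) = gram G (x : H) (A y)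

/-- `x` is a sequence of unit vectors in `dom A` with `(A - z) x n → 0`. -/
def IsApproxEigenseq (A : H →ₗ.[ℂ] H) (z : ℂ) (x : ℕ → A.domain) : Prop :=
  (∀ n, ‖(x n : H)‖ = 1) ∧
    Filter.Tendsto (fun n => A (x n) - z • (x n : H)) Filter.atTop (nhds 0)

/-- The approximate point spectrum of `A` (its finite part, as a subset of `ℂ`). -/
def approxSpectrum (A : H →ₗ.[ℂ] H) : Set ℂ :=
  {z | ∃ x : ℕ → A.domain, IsApproxEigenseq A z x}

/-- The (finite) spectral points of type `π₊`. For selfadjoint `G` the number `[x, x]` is real. The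
sequences of which the lower limit is taken are bounded by `‖G‖`. -/
def typePiPlus (G : H →L[ℂ] H) (A : H →ₗ.[ℂ] H) : Set ℂ :=
  {z | z ∈ approxSpectrum A ∧
    ∃ L : Submodule ℂ H, FiniteDimensional ℂ (H ⧸ L) ∧
      ∀ x : ℕ → A.domain, (∀ n, (x n : H) ∈ L) → IsApproxEigenseq A z x →
        0 < Filter.liminf (fun n => (gram G (x n : H) (x n : H)).re) Filter.atTop}

/-- The (finite) spectral points of type `π₋`. -/
def typePiMinus (G : H →L[ℂ] H) (A : H →ₗ.[ℂ] H) : Set ℂ :=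
  {z | z ∈ approxSpectrum A ∧
    ∃ L : Submodule ℂ H, FiniteDimensional ℂ (H ⧸ L) ∧
      ∀ x : ℕ → A.domain, (∀ n, (x n : H) ∈ L) → IsApproxEigenseq A z x →
        Filter.limsup (fun n => (gram G (x n : H) (x n : H)).re) Filter.atTop < 0}

/-- `R` is the resolvent `(A - z)⁻¹`: a bounded operator on the whole space which is a two-sided
inverse of the bijection `A - z : dom A → H`. -/
def IsResolvent (A : H →ₗ.[ℂ] H) (z : ℂ) (R : H →L[ℂ] H) : Prop :=
  (∀ y : H, ∃ h : R y ∈ A.domain, A ⟨R y, h⟩ - z • R y = y) ∧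
    ∀ x : A.domain, R (A x - z • (x : H)) = x

theorem IsResolvent.unique {A : H →ₗ.[ℂ] H} {z : ℂ} {R S : H →L[ℂ] H}
    (hR : IsResolvent A z R) (hS : IsResolvent A z S) : R = S := by
  ext y
  obtain ⟨h, hy⟩ := hS.1 y
  have := hR.2 ⟨S y, h⟩
  simp only [hy] at this
  exact this

/-- The resolvent set of `A`. -/
def resolventSet (A : H →ₗ.[ℂ] H) : Set ℂ := {z | ∃ R : H →L[ℂ] H, IsResolvent A z R}

/-- The real line as a subset of `ℂ`. -/
def realLine : Set ℂ := {z | z.im = 0}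

/-- The interval `[a, b]` of the real line as a subset of `ℂ`. -/
def realInterval (a b : ℝ) : Set ℂ := (fun t : ℝ => (t : ℂ)) '' Set.Icc a b

end IndefSpec

/-! Passing from `G` to `-G` reduces the `π₋` case to `π₊`, and compactness of `[a, b]` reduces the
claim to a neighbourhood of one real point `s`. There choose `μ = s + it` with `t > 0` small and
replace `A` by bounded operators: `R = (A - μ)⁻¹` and `S_z = (A - z) R = 1 + (μ - z) R`, with `T =
S_s`. Since the resolvent exists off the real line by hypothesis, only a bound `|Im z|^q ‖h‖ ≤ B
‖S_z h‖` is needed.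

If the form were uniformly positive near the kernel of `T`, the identity `Im [S_z k, R k] = -Im z [R
k, R k]` would give this with `q = 1`. Type `π₊` gives positivity only up to finite codimension, and
the defect is collected in a finite-dimensional nonpositive `T`-invariant space `M` on which `T` is
nilpotent. The dimensions of such spaces are bounded (`finrank_nonposRootSpace_le`): nilpotency of
`1 + itR` on `M` forces the trace of `R` there to have modulus `dim M / t`, while `R` is small on a
subspace of `M` of bounded codimension.

Take `M` of maximal dimension, and let `N` be its isotropic part. By `nonpos_vector_or_coercive`,
either some nonzero `h` in the companion of `M`, orthogonal to `N`, satisfies `T h ∈ N` and `[R h, R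
h] ≤ 0`, and then `M + span h` contradicts maximality (`IsNonposRootSpace.extend`), or the form is
coercive there modulo `‖T h‖²` taken modulo `N`. In `pencil_lower_bound` the coercive component
costs one factor `|Im z|`, and the components governed by the nilpotent part cost powers of `|z -
s|`, which dominates `|Im z|`. -/

namespace IndefSpec
open Filter Topology

/-! ### Weak limits and a compactness alternative for quadratic forms -/

section WeakLimits
variable {H : Type*} [NormedAddCommGroup H] [InnerProductSpace ℂ H]

/-- Bounded families in a Hilbert space converge weakly along ultrafilters. -/
theorem exists_weak_limit [CompleteSpace H] {ι : Type*} (F : Ultrafilter ι) (x : ι → H) (C : ℝ)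
    (hx : ∀ i, ‖x i‖ ≤ C) :
    ∃ h : H, ∀ y : H, Tendsto (fun i => inner ℂ y (x i)) F (𝓝 (inner ℂ y h)) := by
  let f : ι → WeakDual ℂ H := fun i => StrongDual.toWeakDual (InnerProductSpace.toDual ℂ H (x i))
  obtain ⟨φ, -, hφ⟩ := (WeakDual.isCompact_closedBall (𝕜 := ℂ) (0 : StrongDual ℂ H)
    C).ultrafilter_le_nhds (F.map f) (by
      rw [le_principal_iff, Ultrafilter.coe_map, Filter.mem_map]
      refine univ_mem' fun i => ?_
      simpa [f] using hx i)
  have hφ' : Tendsto f F (𝓝 φ) := hφ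
  rw [tendsto_iff_forall_eval_tendsto_topDualPairing] at hφ'
  refine ⟨(InnerProductSpace.toDual ℂ H).symm (WeakDual.toStrongDual φ), fun y => ?_⟩
  have h1 := (Complex.continuous_conj.tendsto _).comp (hφ' y)
  have h2 : inner ℂ y ((InnerProductSpace.toDual ℂ H).symm (WeakDual.toStrongDual φ))
      = (starRingEnd ℂ) (topDualPairing ℂ H φ y) := by
    rw [← inner_conj_symm, InnerProductSpace.toDual_symm_apply]; rfl
  rw [h2]
  refine h1.congr fun i => ?_
  simp only [Function.comp]
  rw [← inner_conj_symm y (x i)]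
  rfl

theorem tendsto_starProjection_of_weak {ι : Type*} {l : Filter ι} {x : ι → H} {h : H}
    (hx : ∀ y : H, Tendsto (fun i => inner ℂ y (x i)) l (𝓝 (inner ℂ y h)))
    (W : Submodule ℂ H) [FiniteDimensional ℂ W] :
    Tendsto (fun i => W.starProjection (x i)) l (𝓝 (W.starProjection h)) := by
  have key : ∀ v : H, W.starProjection v =
      ∑ j, inner ℂ ((stdOrthonormalBasis ℂ W j : W) : H) v • ((stdOrthonormalBasis ℂ W j : W) : H) := by
    intro v
    have := (stdOrthonormalBasis ℂ W).sum_repr' (W.orthogonalProjectionOnto v)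
    rw [Submodule.starProjection_apply, ← this]
    push_cast
    refine Finset.sum_congr rfl fun j _ => ?_
    simp
  simp only [key]
  exact tendsto_finsetSum _ fun j _ => (hx _).smul_const _

theorem weak_map [CompleteSpace H] {ι : Type*} {l : Filter ι} {x : ι → H} {h : H}
    (hx : ∀ y : H, Tendsto (fun i => inner ℂ y (x i)) l (𝓝 (inner ℂ y h))) (T : H →L[ℂ] H) (y : H) :
    Tendsto (fun i => inner ℂ y (T (x i))) l (𝓝 (inner ℂ y (T h))) := by
  simpa [ContinuousLinearMap.adjoint_inner_left] using hx (ContinuousLinearMap.adjoint T y)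

/-- A quadratic form which becomes coercive on a subspace of finite codimension after adding a
multiple of `‖T ·‖²` is, on a closed subspace `K` and modulo a finite-dimensional space `N`, either
nonpositive at a nonzero vector of `K ∩ T⁻¹ N`, or coercive up to a multiple of `‖T ·‖²`. -/
theorem nonpos_vector_or_coercive [CompleteSpace H] (E T : H →L[ℂ] H) (W N K : Submodule ℂ H)
    [FiniteDimensional ℂ W] [FiniteDimensional ℂ N] (hK : IsClosed (K : Set H))
    {δ C : ℝ} (hδ : 0 < δ)
    (hW : ∀ v ∈ Wᗮ, δ * ‖v‖ ^ 2 ≤ (inner ℂ v (E v)).re + C * ‖T v‖ ^ 2) :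
    (∃ h ∈ K, h ≠ 0 ∧ T h ∈ N ∧ (inner ℂ h (E h)).re ≤ 0) ∨
    ∃ C' δ' : ℝ, 0 < C' ∧ 0 < δ' ∧ ∀ h ∈ K,
      δ' * ‖h‖ ^ 2 ≤ (inner ℂ h (E h)).re + C' * ‖Nᗮ.starProjection (T h)‖ ^ 2 := by
  by_contra hcon
  push Not at hcon
  obtain ⟨hno, hseq⟩ := hcon
  -- Failure of coercivity is used with `C' = k + 1` and `δ' = 1 / (k + 1)`, then normalised.
  have hex : ∀ k : ℕ, ∃ x ∈ K, ‖x‖ = 1 ∧ (inner ℂ x (E x)).re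
      + ((k : ℝ) + 1) * ‖Nᗮ.starProjection (T x)‖ ^ 2 < 1 / ((k : ℝ) + 1) := by
    intro k
    have hk : (0 : ℝ) < (k : ℝ) + 1 := by positivity
    obtain ⟨h, hK, hlt⟩ := hseq (k + 1) (1 / ((k : ℝ) + 1)) hk (by positivity)
    have h0 : h ≠ 0 := by
      rintro rfl
      simp at hlt
    have hn : 0 < ‖h‖ := norm_pos_iff.2 h0
    refine ⟨((‖h‖⁻¹ : ℝ) : ℂ) • h, K.smul_mem _ hK, ?_, ?_⟩
    · rw [norm_smul, Complex.norm_real, norm_inv, norm_norm, inv_mul_cancel₀ hn.ne']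
    · rw [map_smul, map_smul, map_smul, inner_smul_left, inner_smul_right, norm_smul,
        Complex.conj_ofReal, Complex.re_ofReal_mul, Complex.re_ofReal_mul, Complex.norm_real,
        Real.norm_of_nonneg (inv_nonneg.2 hn.le)]
      have : (‖h‖⁻¹) ^ 2 * ((inner ℂ h (E h)).re + ((k : ℝ) + 1) * ‖Nᗮ.starProjection (T h)‖ ^ 2)
          < (‖h‖⁻¹) ^ 2 * (1 / ((k : ℝ) + 1) * ‖h‖ ^ 2) := by gcongr
      calc _ = (‖h‖⁻¹) ^ 2 * ((inner ℂ h (E h)).re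
              + ((k : ℝ) + 1) * ‖Nᗮ.starProjection (T h)‖ ^ 2) := by ring
        _ < _ := this
        _ = _ := by field_simp
  choose x hxK hx1 hxlt using hex
  let F : Ultrafilter ℕ := hyperfilter ℕ
  have hF : (F : Filter ℕ) ≤ atTop := Nat.hyperfilter_le_atTop
  obtain ⟨h, hh⟩ := exists_weak_limit F x 1 fun i => (hx1 i).le
  have hhK : h ∈ K := by
    have : h ∈ K.topologicalClosure := by
      rw [← Submodule.orthogonal_orthogonal_eq_closure, Submodule.mem_orthogonal]
      intro u hu
      refine tendsto_nhds_unique (hh u) ?_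
      have : (fun i => inner ℂ u (x i)) = fun _ => (0 : ℂ) := by
        funext i
        exact (Submodule.mem_orthogonal' K u).1 hu _ (hxK i)
      rw [this]
      exact tendsto_const_nhds
    rwa [hK.submodule_topologicalClosure_eq] at this
  have hinv : Tendsto (fun k : ℕ => 1 / ((k : ℝ) + 1)) F (𝓝 0) :=
    tendsto_one_div_add_atTop_nhds_zero_nat.mono_left hF
  have hQlow : ∀ v : H, ‖v‖ = 1 → -‖E‖ ≤ (inner ℂ v (E v)).re := by
    intro v hv
    have h1 := (abs_le.1 ((Complex.abs_re_le_norm _).trans (norm_inner_le_norm (𝕜 := ℂ) v (E v)))).1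
    have h2 := E.le_opNorm v
    rw [hv] at h1 h2
    linarith
  have hPT : Tendsto (fun k => Nᗮ.starProjection (T (x k))) F (𝓝 0) := by
    have hsq : Tendsto (fun k => ‖Nᗮ.starProjection (T (x k))‖ ^ 2) F (𝓝 0) := by
      have hb : Tendsto (fun k : ℕ => (1 + ‖E‖) * (1 / ((k : ℝ) + 1))) F (𝓝 0) := by
        simpa using hinv.const_mul (1 + ‖E‖)
      refine squeeze_zero (fun k => by positivity) (fun k => ?_) hb
      have hk : (0 : ℝ) < (k : ℝ) + 1 := by positivity
      have h1 := hxlt k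
      have h2 := hQlow (x k) (hx1 k)
      have h3 : 1 / ((k : ℝ) + 1) ≤ 1 := by
        rw [div_le_one hk]; linarith [Nat.cast_nonneg (α := ℝ) k]
      rw [mul_one_div, le_div_iff₀ hk]
      linarith
    have := hsq.sqrt
    simp only [Real.sqrt_zero] at this
    refine tendsto_zero_iff_norm_tendsto_zero.2 (this.congr fun k => ?_)
    rw [Real.sqrt_sq (norm_nonneg _)]
  have hTw := weak_map hh T
  have hTN : Nᗮ.starProjection (T h) = 0 := by
    rw [← inner_self_eq_zero (𝕜 := ℂ)]
    refine tendsto_nhds_unique (weak_map hTw Nᗮ.starProjection _) ?_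
    have := (tendsto_const_nhds (x := Nᗮ.starProjection (T h))).inner (𝕜 := ℂ) hPT
    rwa [inner_zero_right] at this
  have hThN : T h ∈ N := by
    have := Submodule.starProjection_add_starProjection_orthogonal (K := N) (T h)
    rw [hTN, add_zero] at this
    rw [← this]
    exact Submodule.starProjection_apply_mem _ _
  -- Convergence is strong: the `N`-component because `N` is finite-dimensional, the other because
  -- it tends to `0`.
  have hT : Tendsto (fun k => T (x k)) F (𝓝 (T h)) := by
    have h1 := (tendsto_starProjection_of_weak hTw N).add hPT
    rw [← hTN, Submodule.starProjection_add_starProjection_orthogonal] at h1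
    refine h1.congr fun k => ?_
    exact Submodule.starProjection_add_starProjection_orthogonal _
  -- Removing from `x k - h` its `W`-component, which tends to `0` in norm, makes `hW` applicable.
  -- Weak convergence turns the form at `l k` into the form at `x k` minus the form at `h`,
  -- asymptotically.
  let w : ℕ → H := fun k => W.starProjection (x k - h)
  let l : ℕ → H := fun k => x k - h - w k
  have hw : Tendsto w F (𝓝 0) := by
    have := (tendsto_starProjection_of_weak hh W).sub_const (W.starProjection h)
    simpa [w] using this
  have hlW : ∀ k, l k ∈ Wᗮ := fun k => Submodule.sub_starProjection_mem_orthogonal _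
  have hTl : Tendsto (fun k => T (l k)) F (𝓝 0) := by
    have h1 := (hT.sub_const (T h)).sub ((T.continuous.tendsto 0).comp hw)
    simpa [l] using h1
  have hbd : ∀ k, ‖x k - h‖ ≤ 1 + ‖h‖ := fun k => by
    simpa [hx1 k] using norm_sub_le (x k) h
  have hQ : Tendsto (fun k => (inner ℂ (l k) (E (l k))).re - (inner ℂ (x k) (E (x k))).re) F
      (𝓝 (-(inner ℂ h (E h)).re)) := by
    have e1 : Tendsto (fun k => (inner ℂ h (E (x k)) : ℂ)) F (𝓝 (inner ℂ h (E h))) :=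
      weak_map hh E h
    have e2 : Tendsto (fun k => (inner ℂ (x k) (E h) : ℂ)) F (𝓝 (inner ℂ h (E h))) := by
      have := (Complex.continuous_conj.tendsto _).comp (hh (E h))
      simpa [Function.comp_def] using this
    have bdd0 : ∀ u : ℕ → H, (∀ k, ‖u k‖ ≤ 1 + ‖h‖) →
        Tendsto (fun k => (inner ℂ (u k) (E (w k)) : ℂ)) F (𝓝 0) := by
      intro u hu
      have h3 : Tendsto (fun k => (1 + ‖h‖) * ‖E (w k)‖) F (𝓝 0) := by
        simpa using (((E.continuous.tendsto 0).comp hw).norm).const_mul (1 + ‖h‖)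
      refine squeeze_zero_norm (fun k => ?_) h3
      refine (norm_inner_le_norm _ _).trans ?_
      gcongr
      exact hu k
    have e3 := bdd0 _ hbd
    have e4 : Tendsto (fun k => (inner ℂ (w k) (E (l k)) : ℂ)) F (𝓝 0) := by
      have h3 : Tendsto (fun k => ‖w k‖ * (‖E‖ * (1 + ‖h‖))) F (𝓝 0) := by
        simpa using hw.norm.mul_const (‖E‖ * (1 + ‖h‖))
      refine squeeze_zero_norm (fun k => ?_) h3
      refine (norm_inner_le_norm _ _).trans ?_
      have hl : ‖l k‖ ≤ 1 + ‖h‖ := by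
        have h5 := Submodule.norm_sq_eq_add_norm_sq_starProjection (x k - h) W
        have h6 : l k = Wᗮ.starProjection (x k - h) := by
          have := Submodule.starProjection_add_starProjection_orthogonal (K := W) (x k - h)
          simp only [l, w]
          exact sub_eq_of_eq_add' this.symm
        rw [← h6] at h5
        refine le_trans ?_ (hbd k)
        refine le_of_sq_le_sq ?_ (norm_nonneg _)
        nlinarith [sq_nonneg ‖W.starProjection (x k - h)‖]
      gcongr
      exact (E.le_opNorm _).trans (by gcongr)
    have hc : Tendsto (fun _ : ℕ => (inner ℂ h (E h) : ℂ)) F (𝓝 (inner ℂ h (E h))) :=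
      tendsto_const_nhds
    have e5 := (Complex.continuous_re.tendsto _).comp ((((hc.sub e1).sub e2).sub e3).sub e4)
    have : ((inner ℂ h (E h) : ℂ) - inner ℂ h (E h) - inner ℂ h (E h) - 0 - 0).re
        = -(inner ℂ h (E h)).re := by simp
    rw [this] at e5
    refine e5.congr fun k => ?_
    have h7 : (inner ℂ (l k) (E (l k)) : ℂ) = inner ℂ (x k) (E (x k))
      + (inner ℂ h (E h) - inner ℂ h (E (x k)) - inner ℂ (x k) (E h)
        - inner ℂ (x k - h) (E (w k)) - inner ℂ (w k) (E (l k))) := by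
      have h8 : x k - h = l k + w k := by simp [l]
      have h9 : x k = l k + w k + h := by rw [← h8]; abel
      rw [h8, h9]
      simp only [map_add, inner_add_left, inner_add_right]
      ring
    rw [h7]
    simp [Function.comp]
  have hbound : ∀ k, δ * ‖l k‖ ^ 2 ≤ 1 / ((k : ℝ) + 1)
      + ((inner ℂ (l k) (E (l k))).re - (inner ℂ (x k) (E (x k))).re) + C * ‖T (l k)‖ ^ 2 := by
    intro k
    have h1 := hW _ (hlW k)
    have h2 := hxlt k
    have h3 : 0 ≤ ((k : ℝ) + 1) * ‖Nᗮ.starProjection (T (x k))‖ ^ 2 := by positivity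
    linarith
  have hlim : Tendsto (fun k : ℕ => 1 / ((k : ℝ) + 1)
      + ((inner ℂ (l k) (E (l k))).re - (inner ℂ (x k) (E (x k))).re) + C * ‖T (l k)‖ ^ 2) F
      (𝓝 (-(inner ℂ h (E h)).re)) := by
    have := (hinv.add hQ).add ((hTl.norm.pow 2).const_mul C)
    simpa using this
  -- If `h = 0`, then `‖l k‖ → 1` and the limit of `hbound` reads `δ ≤ 0`. Otherwise it makes the
  -- form nonpositive at `h`, against `hno`.
  by_cases h0 : h = 0
  · have hl1 : Tendsto (fun k => δ * ‖l k‖ ^ 2) F (𝓝 δ) := by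
      have h1 : ∀ k, ‖l k‖ ^ 2 = 1 - ‖w k‖ ^ 2 := by
        intro k
        have h5 := Submodule.norm_sq_eq_add_norm_sq_starProjection (x k - h) W
        have h6 : l k = Wᗮ.starProjection (x k - h) := by
          have := Submodule.starProjection_add_starProjection_orthogonal (K := W) (x k - h)
          simp only [l, w]
          exact sub_eq_of_eq_add' this.symm
        rw [← h6] at h5
        have h7 : ‖x k - h‖ = 1 := by rw [h0, sub_zero, hx1]
        rw [h7] at h5
        simp only [w]
        linarith
      simp only [h1]
      simpa using ((tendsto_const_nhds (x := (1 : ℝ))).sub (hw.norm.pow 2)).const_mul δ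
    have := le_of_tendsto_of_tendsto hl1 hlim (Eventually.of_forall hbound)
    rw [h0] at this
    simp at this
    linarith
  · have h1 := hno h hhK h0 hThN
    have := ge_of_tendsto hlim (Eventually.of_forall fun k =>
      le_trans (by positivity : 0 ≤ δ * ‖l k‖ ^ 2) (hbound k))
    linarith

end WeakLimits

/-! ### The pencil, nonpositive root spaces and the bound on their dimension -/

section Algebra
variable {H : Type*} [NormedAddCommGroup H] [InnerProductSpace ℂ H]

/-- With `R = (A - μ)⁻¹`, the bounded operator `(A - z) R`. -/
noncomputable def pencil (R : H →L[ℂ] H) (μ z : ℂ) : H →L[ℂ] H := 1 + (μ - z) • R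

theorem pencil_apply (R : H →L[ℂ] H) (μ z : ℂ) (h : H) :
    pencil R μ z h = h + (μ - z) • R h := by
  simp [pencil]

theorem gram_add_left (G : H →L[ℂ] H) (x y z : H) :
    gram G (x + y) z = gram G x z + gram G y z := by
  simp [gram]

theorem gram_add_right (G : H →L[ℂ] H) (x y z : H) :
    gram G x (y + z) = gram G x y + gram G x z := by
  simp [gram]

theorem gram_smul_left (G : H →L[ℂ] H) (c : ℂ) (x y : H) :
    gram G (c • x) y = c * gram G x y := by
  simp [gram]

theorem gram_smul_right (G : H →L[ℂ] H) (c : ℂ) (x y : H) :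
    gram G x (c • y) = (starRingEnd ℂ) c * gram G x y := by
  simp [gram, mul_comm]

theorem gram_sub_left (G : H →L[ℂ] H) (x y z : H) :
    gram G (x - y) z = gram G x z - gram G y z := by
  simp [gram]

theorem norm_gram_le (G : H →L[ℂ] H) (x y : H) : ‖gram G x y‖ ≤ ‖G‖ * ‖x‖ * ‖y‖ := by
  calc ‖gram G x y‖ ≤ ‖y‖ * ‖G x‖ := norm_inner_le_norm _ _
    _ ≤ ‖y‖ * (‖G‖ * ‖x‖) := by gcongr; exact G.le_opNorm x
    _ = _ := by ring

theorem abs_re_gram_le (G : H →L[ℂ] H) (x y : H) : |(gram G x y).re| ≤ ‖G‖ * ‖x‖ * ‖y‖ :=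
  (Complex.abs_re_le_norm _).trans (norm_gram_le G x y)

theorem gram_conj [CompleteSpace H] {G : H →L[ℂ] H} (hG : IsSelfAdjoint G) (x y : H) :
    (starRingEnd ℂ) (gram G x y) = gram G y x := by
  rw [gram, inner_conj_symm, gram]
  have := ContinuousLinearMap.adjoint_inner_left G y x
  rw [← ContinuousLinearMap.star_eq_adjoint, hG.star_eq] at this
  exact this

theorem pencil_sub_pencil (R : H →L[ℂ] H) (μ z z' : ℂ) (h : H) :
    pencil R μ z h = pencil R μ z' h + (z' - z) • R h := by
  rw [pencil_apply, pencil_apply, add_assoc, ← add_smul]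
  congr 2
  ring

/-- Eliminating `R` through `T = 1 + itR` makes every `S_z` an affine function of `T`, so that
nilpotency of `T` controls its inverse. -/
theorem pencil_eq_smul_sub {s t : ℝ} (ht : 0 < t) (R : H →L[ℂ] H) (z : ℂ) (h : H) :
    pencil R (s + t * Complex.I) z h = (1 + (s - z) / (t * Complex.I)) •
      pencil R (s + t * Complex.I) s h - ((s - z) / (t * Complex.I)) • h := by
  have hτ : (t * Complex.I : ℂ) ≠ 0 := by simp [ht.ne']
  have hz : (s - z : ℂ) = (s - z) / (t * Complex.I) * (t * Complex.I) :=
    (div_mul_cancel₀ _ hτ).symm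
  set β := (s - z : ℂ) / (t * Complex.I)
  rw [pencil_sub_pencil R _ z s, hz, pencil_apply]
  simp only [add_sub_cancel_left]
  module

/-- On this complement `R` followed by the quotient map is injective: a vector in its kernel is
orthogonal to itself. -/
theorem finiteDimensional_orthogonal (R : H →L[ℂ] H) (L : Submodule ℂ H)
    [FiniteDimensional ℂ (H ⧸ L)] : FiniteDimensional ℂ (L.comap (R : H →ₗ[ℂ] H))ᗮ := by
  let φ : (L.comap (R : H →ₗ[ℂ] H))ᗮ →ₗ[ℂ] (H ⧸ L) :=
    L.mkQ ∘ₗ (R : H →ₗ[ℂ] H) ∘ₗ Submodule.subtype _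
  refine FiniteDimensional.of_injective φ ?_
  rw [← LinearMap.ker_eq_bot, Submodule.eq_bot_iff]
  intro w hw
  have h1 : L.mkQ (R (w : H)) = 0 := hw
  rw [Submodule.mkQ_apply, Submodule.Quotient.mk_eq_zero] at h1
  have h2 := (Submodule.mem_orthogonal _ _).1 w.2 (w : H) h1
  rw [inner_self_eq_zero] at h2
  exact Subtype.ext h2

theorem exists_bounded_preimage (G : H →L[ℂ] H) (M : Submodule ℂ H) [FiniteDimensional ℂ M] :
    ∃ C : ℝ, 0 < C ∧ ∀ f ∈ M.map (G : H →ₗ[ℂ] H), ∃ m ∈ M, G m = f ∧ ‖m‖ ≤ C * ‖f‖ := by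
  let g : M →ₗ[ℂ] M.map (G : H →ₗ[ℂ] H) := (G : H →ₗ[ℂ] H).submoduleMap M
  obtain ⟨i, hi⟩ := g.exists_rightInverse_of_surjective
    (LinearMap.range_eq_top.2 ((G : H →ₗ[ℂ] H).submoduleMap_surjective M))
  let i' := LinearMap.toContinuousLinearMap i
  refine ⟨‖i'‖ + 1, by positivity, fun f hf => ⟨i ⟨f, hf⟩, (i ⟨f, hf⟩).2, ?_, ?_⟩⟩
  · have := LinearMap.congr_fun hi ⟨f, hf⟩
    exact congrArg Subtype.val this
  · have h1 := i'.le_opNorm ⟨f, hf⟩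
    have h2 : ‖(⟨f, hf⟩ : M.map (G : H →ₗ[ℂ] H))‖ = ‖f‖ := rfl
    rw [h2] at h1
    calc ‖((i ⟨f, hf⟩ : M) : H)‖ ≤ ‖i'‖ * ‖f‖ := h1
      _ ≤ _ := by gcongr; linarith

theorem le_mul_of_quadratic {X U a c d : ℝ} (hX : 0 ≤ X) (hU : 0 ≤ U) (ha : 0 ≤ a) (hc : 0 ≤ c)
    (hd : 0 < d) (h : d * X ^ 2 ≤ a * U * X + c * U ^ 2) : X ≤ ((a + c) / d + 1) * U := by
  by_contra hcon
  push Not at hcon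
  have h0 : 0 ≤ (a + c) / d := by positivity
  have h1 : U ≤ X := by nlinarith
  have h2 : d * (((a + c) / d + 1) * U) = (a + c) * U + d * U := by field_simp
  have hXpos : 0 < X := lt_of_le_of_lt (by positivity) hcon
  have h3 : (a + c) * U + d * U < d * X := by
    rw [← h2]; gcongr
  have h4 : ((a + c) * U + d * U) * X < d * X * X := by gcongr
  have h5 : c * U ^ 2 ≤ c * U * X := by nlinarith [mul_nonneg hc hU]
  have h6 : 0 ≤ d * U * X := by positivity
  nlinarith

/-- The form `[·, ·]` is compatible with the pencil of a `G`-symmetric operator. -/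
def PencilSymmetric (G R : H →L[ℂ] H) (μ : ℂ) : Prop :=
  ∀ (z : ℂ) (h k : H), gram G (pencil R μ z h) (R k)
    = gram G (R h) (pencil R μ ((starRingEnd ℂ) z) k)

/-- Finite-dimensional `[·, ·]`-nonpositive `T`-invariant spaces on which `T` is nilpotent. -/
structure IsNonposRootSpace (G T : H →L[ℂ] H) (M : Submodule ℂ H) : Prop where
  fin : FiniteDimensional ℂ M
  map_mem : ∀ m ∈ M, T m ∈ M
  nilp : ∃ p : ℕ, ∀ m ∈ M, (T ^ p) m = 0
  nonpos : ∀ m ∈ M, (gram G m m).re ≤ 0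

theorem isNonposRootSpace_bot (G T : H →L[ℂ] H) : IsNonposRootSpace G T ⊥ where
  fin := inferInstance
  map_mem := by simp
  nilp := ⟨0, by simp⟩
  nonpos := by simp [gram]

theorem pow_map_mem {T : H →L[ℂ] H} {M : Submodule ℂ H} (hT : ∀ m ∈ M, T m ∈ M) (j : ℕ) :
    ∀ m ∈ M, (T ^ j) m ∈ M := by
  induction j with
  | zero => simp
  | succ j ih =>
    intro m hm
    rw [pow_succ]
    exact ih _ (hT m hm)

/-- Up to the factor `β ^ p`, the operators `α T - β` have uniformly bounded inverses on an invariant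
space where `T ^ p = 0`. -/
theorem exists_bounded_inverse {T : H →L[ℂ] H} {M : Submodule ℂ H} (hT : ∀ m ∈ M, T m ∈ M)
    {p : ℕ} (hp : ∀ m ∈ M, (T ^ p) m = 0) :
    ∃ C : ℝ, 0 < C ∧ ∀ α β : ℂ, ‖α‖ ≤ 2 → ‖β‖ ≤ 2 → ∃ J : H →L[ℂ] H, ‖J‖ ≤ C ∧
      (∀ m ∈ M, J m ∈ M) ∧ (∀ m ∈ M, α • T (J m) - β • J m = β ^ p • m) ∧
      ∀ m ∈ M, J (α • T m - β • m) = β ^ p • m := by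
  -- The geometric sum satisfies `(αT - β) S = (αT)^p - β^p`, which is `-β^p` on `M`; hence `J =
  -- -S`. Continuity in `(α, β)` on a compact ball gives the uniform bound.
  let S : ℂ × ℂ → (H →L[ℂ] H) := fun c =>
    ∑ i ∈ Finset.range p, (c.1 • T) ^ i * (c.2 • (1 : H →L[ℂ] H)) ^ (p - 1 - i)
  have hS : Continuous S := by fun_prop
  obtain ⟨C, hC⟩ := (isCompact_closedBall (0 : ℂ × ℂ) 2).exists_bound_of_continuousOn
    hS.continuousOn
  refine ⟨max C 1, by positivity, fun α β hα hβ => ?_⟩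
  have hcomm : Commute (α • T) (β • (1 : H →L[ℂ] H)) := by
    refine Commute.smul_left (Commute.smul_right (Commute.one_right _) _) _
  have hval : ∀ m ∈ M, ((α • T) ^ p - (β • (1 : H →L[ℂ] H)) ^ p) m = -(β ^ p • m) := by
    intro m hm
    simp [smul_pow, hp m hm]
  have hmem : ∀ m ∈ M, S (α, β) m ∈ M := by
    intro m hm
    simp only [S, sum_apply, mul_apply_eq_comp]
    refine M.sum_mem fun i _ => ?_
    refine pow_map_mem (fun m hm => ?_) _ _ (pow_map_mem (fun m hm => ?_) _ _ hm)
    · exact M.smul_mem _ (hT _ hm)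
    · exact M.smul_mem _ hm
  refine ⟨-S (α, β), ?_, fun m hm => ?_, fun m hm => ?_, fun m hm => ?_⟩
  · rw [norm_neg]
    refine (hC (α, β) ?_).trans (le_max_left _ _)
    rw [mem_closedBall_zero_iff, Prod.norm_def]
    exact max_le hα hβ
  · exact M.neg_mem (hmem m hm)
  · have h1 := DFunLike.congr_fun (hcomm.mul_geom_sum₂ p) m
    rw [hval m hm] at h1
    have h2 : α • T (S (α, β) m) - β • S (α, β) m = -(β ^ p • m) := by
      rw [← h1]; rfl
    have h3 : α • T ((-S (α, β)) m) - β • (-S (α, β)) m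
        = -(α • T (S (α, β) m) - β • S (α, β) m) := by
      simp only [neg_apply, map_neg, smul_neg]; abel
    rw [h3, h2, neg_neg]
  · have h1 := DFunLike.congr_fun (hcomm.geom_sum₂_mul p) m
    rw [hval m hm] at h1
    have h2 : S (α, β) (α • T m - β • m) = -(β ^ p • m) := by
      rw [← h1]; rfl
    rw [neg_apply, h2, neg_neg]

/-- The dimension of nonpositive root spaces at `s` is bounded if `[·, ·]` is positive, on a subspace
of finite codimension, at approximate eigenvectors for `s`. -/
theorem finrank_nonposRootSpace_le {G R : H →L[ℂ] H} {s t ε : ℝ} (ht : 0 < t) (hε : 4 * t ≤ ε)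
    {L : Submodule ℂ H} [FiniteDimensional ℂ (H ⧸ L)]
    (hL : ∀ h, R h ∈ L → ‖pencil R (s + t * Complex.I) s h‖ ≤ ε * ‖R h‖ →
      ε * ‖R h‖ ^ 2 ≤ (gram G (R h) (R h)).re)
    {M : Submodule ℂ H} (hM : IsNonposRootSpace G (pencil R (s + t * Complex.I) s) M) :
    (Module.finrank ℂ M : ℝ) ≤ 9 / 4 * t ^ 2 * ‖R‖ ^ 2 * Module.finrank ℂ (H ⧸ L) := by
  set T := pencil R (s + t * Complex.I) s with hTdef
  have hTapp : ∀ h, T h = h + (t * Complex.I) • R h := by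
    intro h
    rw [hTdef, pencil_apply]
    simp
  have hτ : (t * Complex.I : ℂ) ≠ 0 := by simp [ht.ne']
  have hRM : ∀ m ∈ M, R m ∈ M := by
    intro m hm
    have h1 : R m = (t * Complex.I : ℂ)⁻¹ • (T m - m) := by
      rw [hTapp, add_sub_cancel_left, smul_smul, inv_mul_cancel₀ hτ, one_smul]
    rw [h1]
    exact M.smul_mem _ (M.sub_mem (hM.map_mem m hm) hm)
  -- If `T m` is small relative to `R m`, positivity on `L` and nonpositivity on `M` force `R m =
  -- 0`. Otherwise `4t‖R m‖ ≤ ‖T m‖ ≤ ‖m‖ + t‖R m‖`.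
  have hsmall : ∀ m ∈ M, R m ∈ L → 3 * t * ‖R m‖ ≤ ‖m‖ := by
    intro m hm hml
    by_cases hc : ‖T m‖ ≤ ε * ‖R m‖
    · have h1 := hL m hml hc
      have h2 := hM.nonpos _ (hRM m hm)
      have h3 : ‖R m‖ = 0 := by
        have : 0 < ε := by linarith
        have h4 : ‖R m‖ ^ 2 ≤ 0 := by
          by_contra h5
          push Not at h5
          nlinarith
        exact pow_eq_zero_iff (two_ne_zero) |>.1 (le_antisymm h4 (sq_nonneg _))
      rw [h3]; simp
    · push Not at hc
      have h1 : ‖T m‖ ≤ ‖m‖ + t * ‖R m‖ := by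
        rw [hTapp]
        refine (norm_add_le _ _).trans ?_
        rw [norm_smul]
        simp [abs_of_pos ht]
      nlinarith [norm_nonneg (R m)]
  have := hM.fin
  let RM : M →ₗ[ℂ] M := (R : H →ₗ[ℂ] H).restrict hRM
  let TM : M →ₗ[ℂ] M := (T : H →ₗ[ℂ] H).restrict hM.map_mem
  have hRMapp : ∀ m : M, ((RM m : M) : H) = R m := fun m => rfl
  have hTMnil : IsNilpotent TM := by
    obtain ⟨p, hp⟩ := hM.nilp
    refine ⟨p, ?_⟩
    have hpow : ∀ (j : ℕ) (m : M), (((TM ^ j) m : M) : H) = (T ^ j) (m : H) := by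
      intro j
      induction j with
      | zero => simp
      | succ j ih => intro m; rw [pow_succ, pow_succ]; exact ih (TM m)
    ext m
    rw [hpow, hp m m.2]
    simp
  have htrT : LinearMap.trace ℂ M TM = 0 :=
    (LinearMap.isNilpotent_trace_of_isNilpotent hTMnil).eq_zero
  have hTR : TM = LinearMap.id + (t * Complex.I : ℂ) • RM := by
    ext m
    exact hTapp m
  have htr : ‖LinearMap.trace ℂ M RM‖ * t = Module.finrank ℂ M := by
    rw [hTR, map_add, map_smul, LinearMap.trace_id, smul_eq_mul] at htrT
    have h1 : (t * Complex.I : ℂ) * LinearMap.trace ℂ M RM = -(Module.finrank ℂ M : ℂ) :=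
      eq_neg_of_add_eq_zero_right htrT
    have h2 := congrArg norm h1
    rw [norm_mul, norm_neg, Complex.norm_natCast] at h2
    simp only [norm_mul, Complex.norm_real, Complex.norm_I, mul_one, Real.norm_eq_abs,
      abs_of_pos ht] at h2
    rw [← h2, mul_comm]
  let φ : M →ₗ[ℂ] (H ⧸ L) := L.mkQ ∘ₗ (R : H →ₗ[ℂ] H) ∘ₗ M.subtype
  let V : Submodule ℂ M := LinearMap.ker φ
  have hV : ∀ v ∈ V, 3 * t * ‖RM v‖ ≤ ‖v‖ := by
    intro v hv
    refine hsmall v v.2 ?_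
    have : L.mkQ (R (v : H)) = 0 := hv
    rwa [Submodule.mkQ_apply, Submodule.Quotient.mk_eq_zero] at this
  have hVdim : Module.finrank ℂ Vᗮ ≤ Module.finrank ℂ (H ⧸ L) := by
    have h1 := V.finrank_add_finrank_orthogonal
    have h2 := φ.finrank_range_add_finrank_ker
    have h3 := Submodule.finrank_le (LinearMap.range φ)
    change Module.finrank ℂ (LinearMap.range φ) + Module.finrank ℂ V = _ at h2
    omega
  let b := stdOrthonormalBasis ℂ M
  have hb : ∑ i, ‖Vᗮ.starProjection (b i)‖ ^ 2 = Module.finrank ℂ Vᗮ := by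
    have h1 : LinearMap.trace ℂ M (Vᗮ.starProjection : M →L[ℂ] M).toLinearMap
        = Module.finrank ℂ Vᗮ := by
      refine LinearMap.IsProj.trace (p := Vᗮ) ⟨fun x => ?_, fun x hx => ?_⟩
      · exact Submodule.starProjection_apply_mem _ _
      · exact Submodule.starProjection_eq_self_iff.2 hx
    rw [LinearMap.trace_eq_sum_inner _ b] at h1
    have h2 := congrArg Complex.re h1
    rw [Complex.re_sum, Complex.natCast_re] at h2
    rw [← h2]
    refine Finset.sum_congr rfl fun i _ => ?_
    rw [← inner_self_eq_norm_sq (𝕜 := ℂ), ContinuousLinearMap.coe_coe]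
    rw [Submodule.inner_starProjection_left_eq_right,
      Submodule.starProjection_eq_self_iff.2 (Submodule.starProjection_apply_mem _ _)]
    rfl
  have hterm : ∀ i, t * ‖(inner ℂ (b i) (RM (b i)) : ℂ)‖ ≤
      2 / 3 + 3 / 4 * t ^ 2 * ‖R‖ ^ 2 * ‖Vᗮ.starProjection (b i)‖ ^ 2 := by
    intro i
    have hbi : ‖b i‖ = 1 := b.orthonormal.1 i
    have h1 : ‖(inner ℂ (b i) (RM (b i)) : ℂ)‖ ≤ ‖RM (b i)‖ := by
      simpa [hbi] using norm_inner_le_norm (𝕜 := ℂ) (b i) (RM (b i))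
    have h2 : RM (b i) = RM (V.starProjection (b i)) + RM (Vᗮ.starProjection (b i)) := by
      rw [← map_add, Submodule.starProjection_add_starProjection_orthogonal]
    have h3 := hV _ (Submodule.starProjection_apply_mem V (b i))
    have h4 : ‖V.starProjection (b i)‖ ≤ 1 := by
      simpa [hbi] using Submodule.norm_starProjection_apply_le V (b i)
    have h5 : ‖RM (Vᗮ.starProjection (b i))‖ ≤ ‖R‖ * ‖Vᗮ.starProjection (b i)‖ :=
      R.le_opNorm _
    have h6 := norm_add_le (RM (V.starProjection (b i))) (RM (Vᗮ.starProjection (b i)))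
    rw [← h2] at h6
    have h7 : t * ‖RM (b i)‖ ≤ 1 / 3 + t * (‖R‖ * ‖Vᗮ.starProjection (b i)‖) := by
      have h8 : t * ‖RM (b i)‖ ≤ t * (‖RM (V.starProjection (b i))‖
        + ‖R‖ * ‖Vᗮ.starProjection (b i)‖) := by gcongr; linarith
      linarith
    have h9 : t * ‖(inner ℂ (b i) (RM (b i)) : ℂ)‖ ≤ t * ‖RM (b i)‖ := by gcongr
    -- With `x = t‖R‖‖P b i‖`, `P` the projection onto `Vᗮ`, this is `x ≤ 1/3 + (3/4)x²`. The
    -- constants total `2/3 < 1` per basis vector, so they can be absorbed into `dim M`.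
    nlinarith [sq_nonneg (3 / 2 * (t * (‖R‖ * ‖Vᗮ.starProjection (b i)‖)) - 1)]
  have hsum : (Module.finrank ℂ M : ℝ) ≤ 2 / 3 * Module.finrank ℂ M
      + 3 / 4 * t ^ 2 * ‖R‖ ^ 2 * Module.finrank ℂ Vᗮ := by
    calc (Module.finrank ℂ M : ℝ) = t * ‖∑ i, (inner ℂ (b i) (RM (b i)) : ℂ)‖ := by
          rw [← htr, LinearMap.trace_eq_sum_inner _ b, mul_comm]
      _ ≤ t * ∑ i, ‖(inner ℂ (b i) (RM (b i)) : ℂ)‖ := by gcongr; exact norm_sum_le _ _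
      _ = ∑ i, t * ‖(inner ℂ (b i) (RM (b i)) : ℂ)‖ := Finset.mul_sum _ _ _
      _ ≤ ∑ i, (2 / 3 + 3 / 4 * t ^ 2 * ‖R‖ ^ 2 * ‖Vᗮ.starProjection (b i)‖ ^ 2) :=
          Finset.sum_le_sum fun i _ => hterm i
      _ = _ := by
          rw [Finset.sum_add_distrib, ← Finset.mul_sum, hb]
          simp [mul_comm]
  have hfin : (Module.finrank ℂ Vᗮ : ℝ) ≤ Module.finrank ℂ (H ⧸ L) := by exact_mod_cast hVdim
  have : 3 / 4 * t ^ 2 * ‖R‖ ^ 2 * Module.finrank ℂ Vᗮ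
      ≤ 3 / 4 * t ^ 2 * ‖R‖ ^ 2 * Module.finrank ℂ (H ⧸ L) := by gcongr
  linarith

end Algebra

/-! ### Maximal root spaces and coercivity on their companions -/

section Reduction
variable {H : Type*} [NormedAddCommGroup H] [InnerProductSpace ℂ H] [CompleteSpace H]

/-- The orthogonal companion of `M` with respect to `[·, ·]`. -/
noncomputable def gramOrth (G : H →L[ℂ] H) (M : Submodule ℂ H) : Submodule ℂ H :=
  (M.map (G : H →ₗ[ℂ] H))ᗮ

theorem inner_map_eq_gram {G : H →L[ℂ] H} (hG : IsSelfAdjoint G) (m h : H) :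
    inner ℂ (G m) h = gram G h m := by
  have := ContinuousLinearMap.adjoint_inner_left G h m
  rwa [← ContinuousLinearMap.star_eq_adjoint, hG.star_eq] at this

theorem mem_gramOrth {G : H →L[ℂ] H} (hG : IsSelfAdjoint G) {M : Submodule ℂ H} {h : H} :
    h ∈ gramOrth G M ↔ ∀ m ∈ M, gram G h m = 0 := by
  rw [gramOrth, Submodule.mem_orthogonal]
  constructor
  · intro hh m hm
    rw [← inner_map_eq_gram hG]
    exact hh _ ⟨m, hm, rfl⟩
  · rintro hh _ ⟨m, hm, rfl⟩
    exact (inner_map_eq_gram hG m h).trans (hh m hm)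

theorem gram_eq_zero_of_mem {G : H →L[ℂ] H} (hG : IsSelfAdjoint G) {M : Submodule ℂ H} {h m : H}
    (hh : h ∈ gramOrth G M) (hm : m ∈ M) : gram G m h = 0 := by
  rw [← gram_conj hG, (mem_gramOrth hG).1 hh m hm, map_zero]

/-- Where `T h` is not small relative to `R h`, a multiple of `‖T h‖²` outweighs any negativity of
the form; and `‖h‖ ≤ ‖T h‖ + t‖R h‖` replaces `‖R h‖` by `‖h‖`. The estimate is a closed condition,
so it passes to the closure, which is the double orthogonal complement. -/
theorem coercive_of_approx_pos {G R : H →L[ℂ] H} {s t ε : ℝ} (ht : 0 < t) (hε : 0 < ε)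
    {L : Submodule ℂ H}
    (hL : ∀ h, R h ∈ L → ‖pencil R (s + t * Complex.I) s h‖ ≤ ε * ‖R h‖ →
      ε * ‖R h‖ ^ 2 ≤ (gram G (R h) (R h)).re) :
    ∃ δ C : ℝ, 0 < δ ∧ ∀ v ∈ (L.comap (R : H →ₗ[ℂ] H))ᗮᗮ,
      δ * ‖v‖ ^ 2 ≤ (gram G (R v) (R v)).re + C * ‖pencil R (s + t * Complex.I) s v‖ ^ 2 := by
  set T := pencil R (s + t * Complex.I) s with hTdef
  refine ⟨ε / (2 * t ^ 2), (‖G‖ + ε) / ε ^ 2 + ε / t ^ 2, by positivity, ?_⟩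
  have hbase : ∀ h, R h ∈ L → ε / (2 * t ^ 2) * ‖h‖ ^ 2 ≤
      (gram G (R h) (R h)).re + ((‖G‖ + ε) / ε ^ 2 + ε / t ^ 2) * ‖T h‖ ^ 2 := by
    intro h hh
    have h1 : ε * ‖R h‖ ^ 2 ≤ (gram G (R h) (R h)).re + (‖G‖ + ε) / ε ^ 2 * ‖T h‖ ^ 2 := by
      by_cases hc : ‖T h‖ ≤ ε * ‖R h‖
      · have := hL h hh hc
        have h2 : 0 ≤ (‖G‖ + ε) / ε ^ 2 * ‖T h‖ ^ 2 := by positivity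
        linarith
      · push Not at hc
        have h2 := (abs_le.1 (abs_re_gram_le G (R h) (R h))).1
        have h3 : (‖G‖ + ε) / ε ^ 2 * (ε * ‖R h‖) ^ 2 ≤ (‖G‖ + ε) / ε ^ 2 * ‖T h‖ ^ 2 := by
          gcongr
        have h4 : (‖G‖ + ε) / ε ^ 2 * (ε * ‖R h‖) ^ 2 = (‖G‖ + ε) * ‖R h‖ ^ 2 := by
          field_simp
        rw [h4] at h3
        nlinarith
    have h2 : ‖h‖ ≤ ‖T h‖ + t * ‖R h‖ := by
      have h3 : h = T h - (t * Complex.I : ℂ) • R h := by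
        rw [hTdef, pencil_apply]; simp
      calc ‖h‖ = ‖T h - (t * Complex.I : ℂ) • R h‖ := by rw [← h3]
        _ ≤ ‖T h‖ + ‖(t * Complex.I : ℂ) • R h‖ := norm_sub_le _ _
        _ = _ := by rw [norm_smul]; simp [abs_of_pos ht]
    have h3 : ‖h‖ ^ 2 ≤ 2 * ‖T h‖ ^ 2 + 2 * t ^ 2 * ‖R h‖ ^ 2 := by
      have : ‖h‖ ^ 2 ≤ (‖T h‖ + t * ‖R h‖) ^ 2 := by gcongr
      nlinarith [sq_nonneg (‖T h‖ - t * ‖R h‖)]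
    calc ε / (2 * t ^ 2) * ‖h‖ ^ 2 ≤
        ε / (2 * t ^ 2) * (2 * ‖T h‖ ^ 2 + 2 * t ^ 2 * ‖R h‖ ^ 2) := by gcongr
      _ = ε / t ^ 2 * ‖T h‖ ^ 2 + ε * ‖R h‖ ^ 2 := by field_simp
      _ ≤ _ := by linarith
  intro v hv
  rw [Submodule.orthogonal_orthogonal_eq_closure] at hv
  have hcl : IsClosed {v : H | ε / (2 * t ^ 2) * ‖v‖ ^ 2 ≤
      (gram G (R v) (R v)).re + ((‖G‖ + ε) / ε ^ 2 + ε / t ^ 2) * ‖T v‖ ^ 2} := by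
    refine isClosed_le (by fun_prop) ?_
    refine Continuous.add (Complex.continuous_re.comp ?_) (by fun_prop)
    exact (R.continuous.inner (G.continuous.comp R.continuous))
  exact hcl.closure_subset_iff.2 (fun h hh => hbase h hh) hv

/-- `S_μ = 1` and `S_{conj μ} = 2T - 1`, which is invertible on `M` by nilpotency. Any `m ∈ M` is
thus `S_{conj μ} k` with `k ∈ M`, and symmetry gives `[R h, m] = [h, R k] = 0`. -/
theorem map_mem_gramOrth {G R : H →L[ℂ] H} (hG : IsSelfAdjoint G) {s t : ℝ} (ht : 0 < t)
    (hs : PencilSymmetric G R (s + t * Complex.I)) {M : Submodule ℂ H}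
    (hM : IsNonposRootSpace G (pencil R (s + t * Complex.I) s) M) {h : H}
    (hh : h ∈ gramOrth G M) : R h ∈ gramOrth G M := by
  rw [mem_gramOrth hG] at hh ⊢
  intro m hm
  have hτ : (t * Complex.I : ℂ) ≠ 0 := by simp [ht.ne']
  obtain ⟨p, hp⟩ := hM.nilp
  obtain ⟨C, -, hC⟩ := exists_bounded_inverse hM.map_mem hp
  obtain ⟨J, -, hJM, hJ, -⟩ := hC 2 1 (by simp) (by simp)
  have h1 := hs (s + t * Complex.I) h (J m)
  have h2 : pencil R (s + t * Complex.I) (s + t * Complex.I) h = h := by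
    rw [pencil_apply]; simp
  have h3 : pencil R (s + t * Complex.I) ((starRingEnd ℂ) (s + t * Complex.I)) (J m) = m := by
    have h4 := hJ m hm
    rw [one_pow, one_smul, one_smul] at h4
    refine Eq.trans ?_ h4
    rw [pencil_apply, pencil_apply]
    simp
    module
  have h5 : R (J m) = (t * Complex.I : ℂ)⁻¹ • (pencil R (s + t * Complex.I) s (J m) - J m) := by
    rw [pencil_apply, add_sub_cancel_left, smul_smul, add_sub_cancel_left, inv_mul_cancel₀ hτ,
      one_smul]
  have h6 : R (J m) ∈ M := by
    rw [h5]
    exact M.smul_mem _ (M.sub_mem (hM.map_mem _ (hJM m hm)) (hJM m hm))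
  rw [h2, h3, hh _ h6] at h1
  exact h1.symm

/-- Since `h = T h - itR h` and `T h` is isotropic and orthogonal to `R h` in the form, `[h, h] =
t²[R h, R h]`. Moreover `T` maps the larger space into `M`, raising the nilpotency exponent by at
most one. -/
theorem IsNonposRootSpace.extend {G R : H →L[ℂ] H} (hG : IsSelfAdjoint G) {s t : ℝ} (ht : 0 < t)
    {M : Submodule ℂ H} (hM : IsNonposRootSpace G (pencil R (s + t * Complex.I) s) M) {h : H}
    (hh : h ∈ gramOrth G M)
    (hTh : pencil R (s + t * Complex.I) s h ∈ M ⊓ gramOrth G M)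
    (hneg : (gram G (R h) (R h)).re ≤ 0) :
    IsNonposRootSpace G (pencil R (s + t * Complex.I) s) (M ⊔ Submodule.span ℂ {h}) := by
  set T := pencil R (s + t * Complex.I) s with hT
  have hτ : (t * Complex.I : ℂ) ≠ 0 := by simp [ht.ne']
  have := hM.fin
  have hTM : ∀ x ∈ M ⊔ Submodule.span ℂ {h}, T x ∈ M := by
    intro x hx
    obtain ⟨m, hm, y, hy, rfl⟩ := Submodule.mem_sup.1 hx
    obtain ⟨c, rfl⟩ := Submodule.mem_span_singleton.1 hy
    rw [map_add, map_smul]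
    exact M.add_mem (hM.map_mem m hm) (M.smul_mem _ hTh.1)
  refine ⟨inferInstance, fun x hx => Submodule.mem_sup_left (hTM x hx), ?_, ?_⟩
  · obtain ⟨p, hp⟩ := hM.nilp
    refine ⟨p + 1, fun x hx => ?_⟩
    rw [pow_succ]
    exact hp _ (hTM x hx)
  · intro x hx
    obtain ⟨m, hm, y, hy, rfl⟩ := Submodule.mem_sup.1 hx
    obtain ⟨c, rfl⟩ := Submodule.mem_span_singleton.1 hy
    have e1 : gram G h m = 0 := (mem_gramOrth hG).1 hh m hm
    have e2 : gram G m h = 0 := gram_eq_zero_of_mem hG hh hm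
    have hhT : h = T h - (t * Complex.I : ℂ) • R h := by
      rw [hT, pencil_apply]; simp
    have hRh : R h ∈ gramOrth G M := by
      have : R h = (t * Complex.I : ℂ)⁻¹ • (T h - h) := by
        rw [hT, pencil_apply, add_sub_cancel_left, smul_smul, add_sub_cancel_left,
          inv_mul_cancel₀ hτ, one_smul]
      rw [this]
      exact Submodule.smul_mem _ _ (Submodule.sub_mem _ hTh.2 hh)
    have e3 : gram G (R h) (T h) = 0 := (mem_gramOrth hG).1 hRh _ hTh.1
    have e4 : gram G (T h) (R h) = 0 := gram_eq_zero_of_mem hG hRh hTh.1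
    have e5 : gram G (T h) (T h) = 0 := (mem_gramOrth hG).1 hTh.2 _ hTh.1
    have e6 : gram G h h = ((t ^ 2 : ℝ) : ℂ) * gram G (R h) (R h) := by
      have : h = T h + (-(t * Complex.I) : ℂ) • R h := by
        rw [neg_smul, ← sub_eq_add_neg]; exact hhT
      have e : gram G h h = gram G (T h + (-(t * Complex.I) : ℂ) • R h)
          (T h + (-(t * Complex.I) : ℂ) • R h) := by rw [← this]
      rw [e]
      simp only [gram_add_left, gram_add_right, gram_smul_left, gram_smul_right, e3, e4, e5]
      simp
      linear_combination (-(t : ℂ) ^ 2 * gram G (R h) (R h)) * Complex.I_sq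
    have e7 : (gram G h h).re ≤ 0 := by
      rw [e6, Complex.re_ofReal_mul]
      exact mul_nonpos_of_nonneg_of_nonpos (sq_nonneg _) hneg
    have e8 : gram G (m + c • h) (m + c • h)
        = gram G m m + ((Complex.normSq c : ℝ) : ℂ) * gram G h h := by
      simp only [gram_add_left, gram_add_right, gram_smul_left, gram_smul_right, e1, e2]
      rw [Complex.normSq_eq_conj_mul_self]
      ring
    rw [e8, Complex.add_re, Complex.re_ofReal_mul]
    have := mul_nonpos_of_nonneg_of_nonpos (Complex.normSq_nonneg c) e7
    linarith [hM.nonpos m hm]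

/-- Modulo the isotropic part of a maximal nonpositive root space the form `[·, ·]` is coercive near
the kernel of `T`. -/
theorem exists_coercive_rootSpace {G R : H →L[ℂ] H} (hG : IsSelfAdjoint G) {s t ε : ℝ}
    (ht : 0 < t) (hε : 4 * t ≤ ε) {L : Submodule ℂ H} [FiniteDimensional ℂ (H ⧸ L)]
    (hL : ∀ h, R h ∈ L → ‖pencil R (s + t * Complex.I) s h‖ ≤ ε * ‖R h‖ →
      ε * ‖R h‖ ^ 2 ≤ (gram G (R h) (R h)).re) :
    ∃ M : Submodule ℂ H, IsNonposRootSpace G (pencil R (s + t * Complex.I) s) M ∧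
      ∃ C δ : ℝ, 0 < C ∧ 0 < δ ∧ ∀ h ∈ gramOrth G M ⊓ (M ⊓ gramOrth G M)ᗮ,
        δ * ‖h‖ ^ 2 ≤ (gram G (R h) (R h)).re
          + C * ‖(M ⊓ gramOrth G M)ᗮ.starProjection (pencil R (s + t * Complex.I) s h)‖ ^ 2 := by
  set T := pencil R (s + t * Complex.I) s with hT
  let P : ℕ → Prop := fun k => ∃ M, IsNonposRootSpace G T M ∧ Module.finrank ℂ M = k
  have hbdd : BddAbove {k | P k} := by
    refine ⟨⌊9 / 4 * t ^ 2 * ‖R‖ ^ 2 * Module.finrank ℂ (H ⧸ L)⌋₊, ?_⟩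
    rintro k ⟨M, hM, rfl⟩
    exact Nat.le_floor (finrank_nonposRootSpace_le ht hε hL hM)
  obtain ⟨M, hM, hmax⟩ : P (sSup {k | P k}) :=
    Nat.sSup_mem ⟨0, show P 0 from ⟨⊥, isNonposRootSpace_bot G T, finrank_bot ℂ H⟩⟩ hbdd
  have := hM.fin
  have hWfin := finiteDimensional_orthogonal R L
  obtain ⟨δ, C, hδ, hco⟩ := coercive_of_approx_pos ht (by linarith : 0 < ε) hL
  have hNfin : FiniteDimensional ℂ (M ⊓ gramOrth G M : Submodule ℂ H) :=
    Submodule.finiteDimensional_inf_left _ _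
  have hclosed : IsClosed ((gramOrth G M ⊓ (M ⊓ gramOrth G M)ᗮ : Submodule ℂ H) : Set H) :=
    (Submodule.isClosed_orthogonal _).inter (Submodule.isClosed_orthogonal _)
  have hE : ∀ v, (inner ℂ v ((ContinuousLinearMap.adjoint R ∘L G ∘L R) v) : ℂ)
      = gram G (R v) (R v) := by
    intro v
    simp [gram, ContinuousLinearMap.adjoint_inner_right]
  refine ⟨M, hM, ?_⟩
  rcases nonpos_vector_or_coercive (ContinuousLinearMap.adjoint R ∘L G ∘L R) T
    (L.comap (R : H →ₗ[ℂ] H))ᗮ (M ⊓ gramOrth G M) _ hclosed hδ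
    (by simpa only [hE] using hco) with ⟨h, hhK, h0, hTh, hneg⟩ | hgood
  · exfalso
    rw [hE] at hneg
    have hext := hM.extend hG ht hhK.1 hTh hneg
    have hfin := hext.fin
    have hlt : M < M ⊔ Submodule.span ℂ {h} := by
      refine lt_of_le_of_ne le_sup_left fun heq => h0 ?_
      have hm : h ∈ M := by
        rw [heq]
        exact Submodule.mem_sup_right (Submodule.mem_span_singleton_self h)
      have := (Submodule.mem_orthogonal _ _).1 hhK.2 h ⟨hm, hhK.1⟩
      rwa [inner_self_eq_zero] at this
    have h1 := Submodule.finrank_lt_finrank_of_lt hlt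
    have h2 := le_csSup hbdd (show P _ from ⟨_, hext, rfl⟩)
    omega
  · simpa only [hE] using hgood

end Reduction

/-! ### Lower bound for the pencil off the real line -/

section Estimate
variable {H : Type*} [NormedAddCommGroup H] [InnerProductSpace ℂ H] [CompleteSpace H]

/-- The source of the factor `|Im z|`: it bounds `[R k, R k]` by `S_z k`, as for selfadjoint
operators. -/
theorem PencilSymmetric.im_gram {G R : H →L[ℂ] H} (hG : IsSelfAdjoint G) {μ : ℂ}
    (hs : PencilSymmetric G R μ) (z : ℂ) (k : H) :
    (gram G (pencil R μ z k) (R k)).im = -(z.im * (gram G (R k) (R k)).re) := by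
  have h1 := hs z k k
  have h2 : pencil R μ ((starRingEnd ℂ) z) k = pencil R μ z k + (2 * z.im * Complex.I) • R k := by
    rw [pencil_sub_pencil R μ ((starRingEnd ℂ) z) z, Complex.sub_conj]
    push_cast
    rfl
  rw [h2, gram_add_right, gram_smul_right, ← gram_conj hG (pencil R μ z k) (R k)] at h1
  have h3 := congrArg Complex.im h1
  have h4 : (gram G (R k) (R k)).im = 0 := by
    rw [← Complex.conj_eq_iff_im]
    exact gram_conj hG _ _
  simp [h4] at h3
  linarith

set_option maxHeartbeats 1600000 in
/-- Pencils of `G`-symmetric operators are bounded below by a power of `|Im z|` near a point at which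
a nonpositive root space captures the failure of positivity. -/
theorem pencil_lower_bound {G R : H →L[ℂ] H} (hG : IsSelfAdjoint G) {s t : ℝ} (ht : 0 < t)
    (hs : PencilSymmetric G R (s + t * Complex.I)) {M : Submodule ℂ H}
    (hM : IsNonposRootSpace G (pencil R (s + t * Complex.I) s) M) {C δ : ℝ} (hC : 0 < C)
    (hδ : 0 < δ)
    (hco : ∀ h ∈ gramOrth G M ⊓ (M ⊓ gramOrth G M)ᗮ,
      δ * ‖h‖ ^ 2 ≤ (gram G (R h) (R h)).re
        + C * ‖(M ⊓ gramOrth G M)ᗮ.starProjection (pencil R (s + t * Complex.I) s h)‖ ^ 2) :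
    ∃ (r B : ℝ) (q : ℕ), 0 < r ∧ 0 < B ∧ ∀ z : ℂ, ‖z - s‖ < r → z.im ≠ 0 → ∀ h : H,
      |z.im| ^ q * ‖h‖ ≤ B * ‖pencil R (s + t * Complex.I) z h‖ := by
  set μ : ℂ := s + t * Complex.I with hμ
  set N := M ⊓ gramOrth G M with hN
  have := hM.fin
  have hNfin : FiniteDimensional ℂ N := Submodule.finiteDimensional_inf_left _ _
  have hτn : ‖(t * Complex.I : ℂ)‖ = t := by simp [abs_of_pos ht]
  obtain ⟨p, hp⟩ := hM.nilp
  obtain ⟨CJ, hCJ, hJ⟩ := exists_bounded_inverse hM.map_mem hp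
  obtain ⟨C₂, hC₂, hpre⟩ := exists_bounded_preimage G M
  set σ : ℝ := 1 + 2 * t * ‖R‖ with hσ
  set C₁ : ℝ := ‖G‖ * (1 + 2 * t * ‖R‖ * CJ) with hC₁
  set C₃ : ℝ := 1 + σ * (C₁ * C₂) with hC₃
  set C₄ : ℝ := (‖G‖ * ‖R‖ + 2 * C) / (δ / 2) + 1 with hC₄
  have hσ0 : 0 < σ := by positivity
  have hC₁0 : 0 ≤ C₁ := by positivity
  have hC₃0 : 0 < C₃ := by positivity
  have hC₄0 : 0 < C₄ := by positivity
  set C₅ : ℝ := C₁ * C₂ + C₄ * C₃ + CJ * (1 + σ * C₄) * C₃ with hC₅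
  have hC₅0 : 0 < C₅ := by positivity
  -- The last radius absorbs the error of replacing `S_s` by `S_z` into half of `δ`. The exponent is
  -- one from the coercive part plus `p` for each of two inversions on `M`.
  refine ⟨min (min t 1) (δ / (4 * C * (‖R‖ ^ 2 + 1))), C₅ * t ^ (2 * p), 2 * p + 1,
    by positivity, by positivity, fun z hz him h => ?_⟩
  have hzt : ‖z - s‖ ≤ t := hz.le.trans ((min_le_left _ _).trans (min_le_left _ _))
  have hz1 : ‖z - s‖ ≤ 1 := hz.le.trans ((min_le_left _ _).trans (min_le_right _ _))
  have hzδ : ‖z - s‖ ≤ δ / (4 * C * (‖R‖ ^ 2 + 1)) := hz.le.trans (min_le_right _ _)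
  set y : ℝ := |z.im| with hy
  have hy0 : 0 < y := abs_pos.2 him
  have hyz : y ≤ ‖z - s‖ := by
    have := Complex.abs_im_le_norm (z - s)
    simpa [hy] using this
  have hy1 : y ≤ 1 := hyz.trans hz1
  set ω : ℝ := ‖z - s‖ / t with hω
  have hω1 : ω ≤ 1 := by rw [hω, div_le_one ht]; exact hzt
  have hω0 : 0 ≤ ω := by positivity
  have hωp1 : ω ^ p ≤ 1 := pow_le_one₀ hω0 hω1
  have hωp0 : 0 ≤ ω ^ p := by positivity
  have hinv : ∀ z' : ℂ, ‖(s - z' : ℂ)‖ = ‖z - s‖ → ∃ J : H →L[ℂ] H, ‖J‖ ≤ CJ ∧ ∃ c : ℂ,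
      ‖c‖ = ω ^ p ∧ ∀ m ∈ M, J m ∈ M ∧ pencil R μ z' (J m) = c • m ∧
        J (pencil R μ z' m) = c • m := by
    intro z' hz'
    set β : ℂ := (s - z') / (t * Complex.I) with hβ
    have hβn : ‖β‖ = ω := by rw [hβ, norm_div, hτn, hz']
    have hα : ‖1 + β‖ ≤ 2 := by
      refine (norm_add_le _ _).trans ?_
      rw [hβn, norm_one]; linarith
    obtain ⟨J, hJn, hJM, hJ1, hJ2⟩ := hJ (1 + β) β hα (by rw [hβn]; linarith)
    refine ⟨J, hJn, β ^ p, by rw [norm_pow, hβn], fun m hm => ⟨hJM m hm, ?_, ?_⟩⟩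
    · rw [hμ, pencil_eq_smul_sub ht]
      exact hJ1 m hm
    · rw [hμ, pencil_eq_smul_sub ht]
      exact hJ2 m hm
  have hlowM : ∀ m ∈ M, ω ^ p * ‖m‖ ≤ CJ * ‖pencil R μ z m‖ := by
    intro m hm
    obtain ⟨J, hJn, c, hc, hJm⟩ := hinv z (norm_sub_rev _ _)
    calc ω ^ p * ‖m‖ = ‖J (pencil R μ z m)‖ := by rw [(hJm m hm).2.2, norm_smul, hc]
      _ ≤ ‖J‖ * ‖pencil R μ z m‖ := J.le_opNorm _
      _ ≤ _ := by gcongr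
  have hμz : ‖μ - z‖ ≤ 2 * t := by
    have : μ - z = t * Complex.I - (z - s) := by rw [hμ]; ring
    rw [this]
    refine (norm_sub_le _ _).trans ?_
    rw [hτn]; linarith
  have hSz : ∀ v, ‖pencil R μ z v‖ ≤ σ * ‖v‖ := by
    intro v
    rw [pencil_apply]
    calc ‖v + (μ - z) • R v‖ ≤ ‖v‖ + ‖μ - z‖ * ‖R v‖ := by
          rw [← norm_smul]; exact norm_add_le _ _
      _ ≤ ‖v‖ + 2 * t * (‖R‖ * ‖v‖) := by gcongr; exact R.le_opNorm v
      _ = _ := by rw [hσ]; ring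
  have hRM : ∀ m ∈ M, R m ∈ M := by
    intro m hm
    have hτ : (t * Complex.I : ℂ) ≠ 0 := by simp [ht.ne']
    have h1 : R m = (t * Complex.I : ℂ)⁻¹ • (pencil R μ s m - m) := by
      rw [pencil_apply, add_sub_cancel_left, smul_smul, hμ, add_sub_cancel_left,
        inv_mul_cancel₀ hτ, one_smul]
    rw [h1]
    exact M.smul_mem _ (M.sub_mem (hM.map_mem m hm) hm)
  have hRN : ∀ n ∈ N, R n ∈ N := fun n hn => ⟨hRM n hn.1, map_mem_gramOrth hG ht hs hM hn.2⟩
  have hSN : ∀ n ∈ N, pencil R μ z n ∈ N := by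
    intro n hn
    rw [pencil_apply]
    exact N.add_mem hn (N.smul_mem _ (hRN n hn))
  set u := pencil R μ z h with hu
  -- the functionals `[h, m]`, `m ∈ M`
  have hfun : ∀ m ∈ M, ω ^ p * ‖gram G h m‖ ≤ C₁ * ‖u‖ * ‖m‖ := by
    intro m hm
    obtain ⟨J, hJn, c, hc, hJm⟩ := hinv ((starRingEnd ℂ) z) (by
      rw [norm_sub_rev, ← Complex.norm_conj (z - s)]; simp)
    have h1 := hs z h (J m)
    rw [(hJm m hm).2.1, gram_smul_right, ← hu] at h1
    have h2 : ω ^ p * ‖gram G (R h) m‖ ≤ ‖G‖ * ‖u‖ * (‖R‖ * (CJ * ‖m‖)) := by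
      calc ω ^ p * ‖gram G (R h) m‖ = ‖gram G u (R (J m))‖ := by
            rw [h1, norm_mul, Complex.norm_conj, hc]
        _ ≤ ‖G‖ * ‖u‖ * ‖R (J m)‖ := norm_gram_le _ _ _
        _ ≤ ‖G‖ * ‖u‖ * (‖R‖ * (CJ * ‖m‖)) := by
            gcongr
            refine (R.le_opNorm _).trans ?_
            gcongr
            refine (J.le_opNorm _).trans ?_
            gcongr
    have h3 : h = u - (μ - z) • R h := by
      rw [hu, pencil_apply]; simp
    have h4 : ‖gram G h m‖ ≤ ‖G‖ * ‖u‖ * ‖m‖ + 2 * t * ‖gram G (R h) m‖ := by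
      have h5 : gram G h m = gram G u m - (μ - z) * gram G (R h) m := by
        rw [← gram_smul_left, ← gram_sub_left, ← h3]
      rw [h5]
      refine (norm_sub_le _ _).trans ?_
      rw [norm_mul]
      gcongr
      exact norm_gram_le _ _ _
    calc ω ^ p * ‖gram G h m‖ ≤ ω ^ p * (‖G‖ * ‖u‖ * ‖m‖ + 2 * t * ‖gram G (R h) m‖) := by
          gcongr
      _ = ω ^ p * (‖G‖ * ‖u‖ * ‖m‖) + 2 * t * (ω ^ p * ‖gram G (R h) m‖) := by ring
      _ ≤ 1 * (‖G‖ * ‖u‖ * ‖m‖) + 2 * t * (‖G‖ * ‖u‖ * (‖R‖ * (CJ * ‖m‖))) := by gcongr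
      _ = _ := by rw [hC₁]; ring
  -- splitting off the component in `G M`
  obtain ⟨f, hf, h', hh', hsum⟩ :=
    Submodule.exists_add_mem_mem_orthogonal (K := M.map (G : H →ₗ[ℂ] H)) h
  have hfn : ω ^ p * ‖f‖ ≤ C₁ * C₂ * ‖u‖ := by
    obtain ⟨m, hm, hGm, hmn⟩ := hpre f hf
    have h1 : (inner ℂ f h : ℂ) = ((‖f‖ ^ 2 : ℝ) : ℂ) := by
      rw [hsum, inner_add_right, (Submodule.mem_orthogonal _ _).1 hh' f hf, add_zero,
        inner_self_eq_norm_sq_to_K]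
      simp
    have h2 : ‖gram G h m‖ = ‖f‖ ^ 2 := by
      rw [← inner_map_eq_gram hG, hGm, h1, Complex.norm_real, Real.norm_of_nonneg (sq_nonneg _)]
    have h3 := hfun m hm
    rw [h2] at h3
    by_cases hf0 : ‖f‖ = 0
    · rw [hf0]; simp; positivity
    · have hfpos : 0 < ‖f‖ := lt_of_le_of_ne (norm_nonneg _) (Ne.symm hf0)
      have h4 : C₁ * ‖u‖ * ‖m‖ ≤ C₁ * ‖u‖ * (C₂ * ‖f‖) := by gcongr
      refine le_of_mul_le_mul_right ?_ hfpos
      calc ω ^ p * ‖f‖ * ‖f‖ = ω ^ p * ‖f‖ ^ 2 := by ring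
        _ ≤ _ := h3.trans h4
        _ = _ := by ring
  set u' := pencil R μ z h' with hu'
  have hu'n : ω ^ p * ‖u'‖ ≤ C₃ * ‖u‖ := by
    have h1 : u' = u - pencil R μ z f := by
      rw [hu, hsum, map_add]; simp [hu']
    have h2 : ‖u'‖ ≤ ‖u‖ + σ * ‖f‖ := by
      rw [h1]
      exact (norm_sub_le _ _).trans (by gcongr; exact hSz f)
    calc ω ^ p * ‖u'‖ ≤ ω ^ p * (‖u‖ + σ * ‖f‖) := by gcongr
      _ = ω ^ p * ‖u‖ + σ * (ω ^ p * ‖f‖) := by ring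
      _ ≤ 1 * ‖u‖ + σ * (C₁ * C₂ * ‖u‖) := by gcongr
      _ = _ := by rw [hC₃]; ring
  -- splitting off the component in `N`
  obtain ⟨n, hn, k, hk, hsum'⟩ := Submodule.exists_add_mem_mem_orthogonal (K := N) h'
  have hkG : k ∈ gramOrth G M := by
    have : k = h' - n := by rw [hsum']; simp
    rw [this]
    exact Submodule.sub_mem _ hh' hn.2
  have hu'k : u' = pencil R μ z n + pencil R μ z k := by rw [hu', hsum', map_add]
  -- `N` is invariant under `S_z`, so the still uncontrolled `n` disappears modulo `N`.
  have hPk : Nᗮ.starProjection (pencil R μ z k) = Nᗮ.starProjection u' := by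
    have h1 : Nᗮ.starProjection (pencil R μ z n) = 0 := by
      rw [Submodule.starProjection_apply_eq_zero_iff, Submodule.orthogonal_orthogonal]
      exact hSN n hn
    rw [hu'k, map_add, h1, zero_add]
  have hPle : ∀ v, ‖Nᗮ.starProjection v‖ ≤ ‖v‖ := fun v =>
    Submodule.norm_starProjection_apply_le _ v
  have hPT : ‖Nᗮ.starProjection (pencil R μ s k)‖ ≤ ‖u'‖ + ‖z - s‖ * (‖R‖ * ‖k‖) := by
    rw [pencil_sub_pencil R μ s z, map_add, hPk]
    refine (norm_add_le _ _).trans ?_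
    gcongr
    · exact hPle _
    · refine (hPle _).trans ?_
      rw [norm_smul]
      gcongr
      exact R.le_opNorm k
  have hquad : δ / 2 * ‖k‖ ^ 2 ≤ (gram G (R k) (R k)).re + 2 * C * ‖u'‖ ^ 2 := by
    have h1 := hco k ⟨hkG, hk⟩
    have h2 : ‖Nᗮ.starProjection (pencil R μ s k)‖ ^ 2
        ≤ 2 * ‖u'‖ ^ 2 + 2 * (‖z - s‖ * (‖R‖ * ‖k‖)) ^ 2 := by
      calc _ ≤ (‖u'‖ + ‖z - s‖ * (‖R‖ * ‖k‖)) ^ 2 := by gcongr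
        _ ≤ _ := by nlinarith [sq_nonneg (‖u'‖ - ‖z - s‖ * (‖R‖ * ‖k‖))]
    have h3 : 2 * C * (‖z - s‖ * (‖R‖ * ‖k‖)) ^ 2 ≤ δ / 2 * ‖k‖ ^ 2 := by
      have h4 : ‖z - s‖ ^ 2 ≤ δ / (4 * C * (‖R‖ ^ 2 + 1)) := by
        refine le_trans ?_ hzδ
        nlinarith [norm_nonneg (z - s)]
      have h5 : ‖z - s‖ ^ 2 * (4 * C * (‖R‖ ^ 2 + 1)) ≤ δ :=
        (le_div_iff₀ (by positivity)).1 h4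
      have h6 : 4 * C * (‖z - s‖ ^ 2 * ‖R‖ ^ 2) ≤ δ := by
        have : 0 ≤ 4 * C * ‖z - s‖ ^ 2 := by positivity
        nlinarith
      calc 2 * C * (‖z - s‖ * (‖R‖ * ‖k‖)) ^ 2
          = 4 * C * (‖z - s‖ ^ 2 * ‖R‖ ^ 2) / 2 * ‖k‖ ^ 2 := by ring
        _ ≤ δ / 2 * ‖k‖ ^ 2 := by gcongr
    have h7 := mul_le_mul_of_nonneg_left h2 hC.le
    linarith
  -- The `N`-component of `S_z k` drops out of the form because `R k` stays in the companion of `M`.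
  have hQ : y * (gram G (R k) (R k)).re ≤ ‖G‖ * ‖R‖ * ‖u'‖ * ‖k‖ := by
    have h1 := hs.im_gram hG z k
    have h2 : gram G (pencil R μ z k) (R k)
        = gram G (Nᗮ.starProjection u') (R k) := by
      rw [← Submodule.starProjection_add_starProjection_orthogonal (K := N) (pencil R μ z k),
        gram_add_left, hPk, gram_eq_zero_of_mem hG (map_mem_gramOrth hG ht hs hM hkG)
          (Submodule.starProjection_apply_mem N _).1, zero_add]
    calc y * (gram G (R k) (R k)).re ≤ |z.im * (gram G (R k) (R k)).re| := by
          rw [abs_mul, ← hy]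
          gcongr
          exact le_abs_self _
      _ = |(gram G (pencil R μ z k) (R k)).im| := by rw [h1, abs_neg]
      _ ≤ ‖gram G (pencil R μ z k) (R k)‖ := Complex.abs_im_le_norm _
      _ ≤ ‖G‖ * ‖Nᗮ.starProjection u'‖ * ‖R k‖ := by rw [h2]; exact norm_gram_le _ _ _
      _ ≤ ‖G‖ * ‖u'‖ * (‖R‖ * ‖k‖) := by
          gcongr
          · exact hPle _
          · exact R.le_opNorm k
      _ = _ := by ring
  have hkn : y * ‖k‖ ≤ C₄ * ‖u'‖ := by
    refine le_mul_of_quadratic (by positivity) (norm_nonneg _) (by positivity) (by positivity)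
      (by positivity) ?_
    calc δ / 2 * (y * ‖k‖) ^ 2 = y ^ 2 * (δ / 2 * ‖k‖ ^ 2) := by ring
      _ ≤ y ^ 2 * ((gram G (R k) (R k)).re + 2 * C * ‖u'‖ ^ 2) := by gcongr
      _ = y * (y * (gram G (R k) (R k)).re) + y ^ 2 * (2 * C * ‖u'‖ ^ 2) := by ring
      _ ≤ y * (‖G‖ * ‖R‖ * ‖u'‖ * ‖k‖) + 1 * (2 * C * ‖u'‖ ^ 2) := by
          gcongr
          exact pow_le_one₀ hy0.le hy1
      _ = _ := by ring
  have hnn : y * (ω ^ p * ‖n‖) ≤ CJ * (1 + σ * C₄) * ‖u'‖ := by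
    have h1 : pencil R μ z n = u' - pencil R μ z k := by rw [hu'k]; simp
    have h2 : ‖pencil R μ z n‖ ≤ ‖u'‖ + σ * ‖k‖ := by
      rw [h1]
      exact (norm_sub_le _ _).trans (by gcongr; exact hSz k)
    calc y * (ω ^ p * ‖n‖) ≤ y * (CJ * ‖pencil R μ z n‖) :=
          mul_le_mul_of_nonneg_left (hlowM n hn.1) hy0.le
      _ ≤ y * (CJ * (‖u'‖ + σ * ‖k‖)) := by gcongr
      _ = CJ * (y * ‖u'‖ + σ * (y * ‖k‖)) := by ring
      _ ≤ CJ * (1 * ‖u'‖ + σ * (C₄ * ‖u'‖)) := by gcongr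
      _ = _ := by ring
  have hhn : ‖h‖ ≤ ‖f‖ + ‖k‖ + ‖n‖ := by
    rw [hsum, hsum']
    refine (norm_add_le _ _).trans ?_
    have := norm_add_le n k
    linarith
  have hmain : y * (ω ^ p * ω ^ p) * ‖h‖ ≤ C₅ * ‖u‖ := by
    calc y * (ω ^ p * ω ^ p) * ‖h‖ ≤ y * (ω ^ p * ω ^ p) * (‖f‖ + ‖k‖ + ‖n‖) := by gcongr
      _ = y * ω ^ p * (ω ^ p * ‖f‖) + ω ^ p * (ω ^ p * (y * ‖k‖))
          + ω ^ p * (y * (ω ^ p * ‖n‖)) := by ring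
      _ ≤ 1 * 1 * (C₁ * C₂ * ‖u‖) + 1 * (ω ^ p * (C₄ * ‖u'‖))
          + ω ^ p * (CJ * (1 + σ * C₄) * ‖u'‖) := by gcongr
      _ = C₁ * C₂ * ‖u‖ + C₄ * (ω ^ p * ‖u'‖) + CJ * (1 + σ * C₄) * (ω ^ p * ‖u'‖) := by ring
      _ ≤ C₁ * C₂ * ‖u‖ + C₄ * (C₃ * ‖u‖) + CJ * (1 + σ * C₄) * (C₃ * ‖u‖) := by gcongr
      _ = _ := by rw [hC₅]; ring
  have hyω : y ≤ t * ω := by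
    rw [hω, mul_div_cancel₀ _ ht.ne']; exact hyz
  calc y ^ (2 * p + 1) * ‖h‖ = y * y ^ (2 * p) * ‖h‖ := by ring
    _ ≤ y * (t * ω) ^ (2 * p) * ‖h‖ := by gcongr
    _ = t ^ (2 * p) * (y * (ω ^ p * ω ^ p) * ‖h‖) := by ring
    _ ≤ t ^ (2 * p) * (C₅ * ‖u‖) := by gcongr
    _ = _ := by ring

end Estimate

/-! ### From spectral type to resolvent growth -/

section Resolvent
variable {H : Type*} [NormedAddCommGroup H] [InnerProductSpace ℂ H]

/-- If no `ε` worked, normalised counterexamples for `ε = 1 / (n + 1)` would form an approximate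
eigensequence violating the hypothesis. -/
theorem exists_approx_pos {G : H →L[ℂ] H} {A : H →ₗ.[ℂ] H} {z : ℂ} {L : Submodule ℂ H}
    (hL : ∀ x : ℕ → A.domain, (∀ n, (x n : H) ∈ L) → IsApproxEigenseq A z x →
      ∃ n : ℕ, 1 / ((n : ℝ) + 1) ≤ (gram G (x n : H) (x n : H)).re) :
    ∃ ε : ℝ, 0 < ε ∧ ∀ x : A.domain, (x : H) ∈ L → ‖A x - z • (x : H)‖ ≤ ε * ‖(x : H)‖ →
      ε * ‖(x : H)‖ ^ 2 ≤ (gram G (x : H) (x : H)).re := by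
  by_contra hcon
  push Not at hcon
  have hex : ∀ n : ℕ, ∃ x : A.domain, (x : H) ∈ L ∧ ‖(x : H)‖ = 1 ∧
      ‖A x - z • (x : H)‖ ≤ 1 / ((n : ℝ) + 1) ∧
      (gram G (x : H) (x : H)).re < 1 / ((n : ℝ) + 1) := by
    intro n
    obtain ⟨x, hxL, hx1, hx2⟩ := hcon (1 / ((n : ℝ) + 1)) (by positivity)
    have hx0 : (x : H) ≠ 0 := by
      intro h0
      rw [h0] at hx2
      simp [gram] at hx2
    have hn : 0 < ‖(x : H)‖ := norm_pos_iff.2 hx0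
    have hc : ‖((‖(x : H)‖⁻¹ : ℝ) : ℂ)‖ = ‖(x : H)‖⁻¹ := by
      rw [Complex.norm_real, norm_inv, norm_norm]
    refine ⟨((‖(x : H)‖⁻¹ : ℝ) : ℂ) • x, L.smul_mem _ hxL, ?_, ?_, ?_⟩
    · rw [Submodule.coe_smul, norm_smul, hc, inv_mul_cancel₀ hn.ne']
    · rw [LinearPMap.map_smul, Submodule.coe_smul, smul_comm, ← smul_sub, norm_smul, hc,
        inv_mul_le_iff₀ hn, mul_comm]
      exact hx1
    · rw [Submodule.coe_smul, gram_smul_left, gram_smul_right, Complex.conj_ofReal,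
        Complex.re_ofReal_mul, Complex.re_ofReal_mul]
      calc ‖(x : H)‖⁻¹ * (‖(x : H)‖⁻¹ * (gram G (x : H) (x : H)).re)
          < ‖(x : H)‖⁻¹ * (‖(x : H)‖⁻¹ * (1 / ((n : ℝ) + 1) * ‖(x : H)‖ ^ 2)) := by gcongr
        _ = _ := by field_simp
  choose x hxL hx1 hx2 hx3 using hex
  obtain ⟨n, hn⟩ := hL x hxL ⟨hx1, squeeze_zero_norm hx2 tendsto_one_div_add_atTop_nhds_zero_nat⟩
  exact absurd (hx3 n) (not_lt.2 hn)

theorem exists_approx_pos_of_typePiPlus {G : H →L[ℂ] H} {A : H →ₗ.[ℂ] H} {z : ℂ}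
    (hz : z ∈ approxSpectrum A → z ∈ typePiPlus G A) :
    ∃ L : Submodule ℂ H, FiniteDimensional ℂ (H ⧸ L) ∧ ∃ ε : ℝ, 0 < ε ∧ ∀ x : A.domain,
      (x : H) ∈ L → ‖A x - z • (x : H)‖ ≤ ε * ‖(x : H)‖ →
      ε * ‖(x : H)‖ ^ 2 ≤ (gram G (x : H) (x : H)).re := by
  by_cases hap : z ∈ approxSpectrum A
  · obtain ⟨-, L, hfin, hL⟩ := hz hap
    refine ⟨L, hfin, exists_approx_pos fun x hxL hx => ?_⟩
    by_contra hcon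
    push Not at hcon
    obtain ⟨c, hc0, hc⟩ := exists_between (hL x hxL hx)
    have hbdd : IsBoundedUnder (· ≥ ·) atTop
        (fun n => (gram G (x n : H) (x n : H)).re) := by
      refine isBoundedUnder_of ⟨-‖G‖, fun n => ?_⟩
      have := (abs_le.1 (abs_re_gram_le G (x n : H) (x n : H))).1
      rwa [hx.1 n, mul_one, mul_one] at this
    have h1 := eventually_lt_of_lt_liminf hc hbdd
    have h2 := (tendsto_one_div_add_atTop_nhds_zero_nat (𝕜 := ℝ)).eventually_lt_const hc0
    obtain ⟨n, hn1, hn2⟩ := (h1.and h2).exists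
    linarith [hcon n]
  -- Outside the approximate point spectrum there are no such sequences, so the whole space serves.
  · refine ⟨⊤, inferInstance, exists_approx_pos fun x _ hx => ?_⟩
    exact absurd ⟨x, hx⟩ hap

theorem typePiMinus_subset (G : H →L[ℂ] H) (A : H →ₗ.[ℂ] H) :
    typePiMinus G A ⊆ typePiPlus (-G) A := by
  rintro z ⟨hap, L, hfin, hL⟩
  refine ⟨hap, L, hfin, fun x hxL hx => ?_⟩
  have hneg : ∀ n, (gram (-G) (x n : H) (x n : H)).re = -(gram G (x n : H) (x n : H)).re := by
    intro n
    simp [gram]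
  have hle : ∀ n, |(gram G (x n : H) (x n : H)).re| ≤ ‖G‖ := by
    intro n
    have := abs_re_gram_le G (x n : H) (x n : H)
    rwa [hx.1 n, mul_one, mul_one] at this
  obtain ⟨c, hc, hc0⟩ := exists_between (hL x hxL hx)
  have h1 := eventually_lt_of_limsup_lt hc
    (isBoundedUnder_of ⟨‖G‖, fun n => (abs_le.1 (hle n)).2⟩)
  simp only [hneg]
  refine lt_of_lt_of_le (neg_pos.2 hc0) (le_liminf_of_le ?_ ?_)
  · exact (isBoundedUnder_of ⟨‖G‖, fun n => by
      have := (abs_le.1 (hle n)).1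
      change -(gram G (x n : H) (x n : H)).re ≤ ‖G‖
      linarith⟩ : IsBoundedUnder (· ≤ ·) atTop _).isCoboundedUnder_ge
  · filter_upwards [h1] with n hn
    linarith

theorem IsResolvent.pencil_eq {A : H →ₗ.[ℂ] H} {μ : ℂ} {R : H →L[ℂ] H} (hR : IsResolvent A μ R)
    (z : ℂ) (h : H) : A ⟨R h, (hR.1 h).1⟩ - z • R h = pencil R μ z h := by
  obtain ⟨hd, hy⟩ := hR.1 h
  calc A ⟨R h, hd⟩ - z • R h = (A ⟨R h, hd⟩ - μ • R h) + (μ - z) • R h := by module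
    _ = pencil R μ z h := by rw [hy, pencil_apply]

theorem IsResolvent.pencilSymmetric {G : H →L[ℂ] H} {A : H →ₗ.[ℂ] H} (hsymm : GSymmetric G A)
    {μ : ℂ} {R : H →L[ℂ] H} (hR : IsResolvent A μ R) : PencilSymmetric G R μ := by
  intro z h k
  have h1 := hsymm ⟨R h, (hR.1 h).1⟩ ⟨R k, (hR.1 k).1⟩
  rw [← hR.pencil_eq, ← hR.pencil_eq, sub_eq_add_neg, sub_eq_add_neg, ← neg_smul, ← neg_smul,
    gram_add_left, gram_add_right, gram_smul_left, gram_smul_right, h1]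
  simp

/-- Near a real point of type `π₊` (or outside the approximate point spectrum) the resolvent grows
at most polynomially in `|Im z|⁻¹`. -/
theorem resolvent_growth_near [CompleteSpace H] {G : H →L[ℂ] H} (hG : IsSelfAdjoint G)
    {A : H →ₗ.[ℂ] H} (hsymm : GSymmetric G A) {s : ℝ}
    (hz : (s : ℂ) ∈ approxSpectrum A → (s : ℂ) ∈ typePiPlus G A)
    {U : Set ℂ} (hU : IsOpen U) (hsU : (s : ℂ) ∈ U) (hUρ : U \ realLine ⊆ resolventSet A) :
    ∃ (r B : ℝ) (q : ℕ), 0 < r ∧ 0 < B ∧ ∀ z : ℂ, ‖z - s‖ < r → z.im ≠ 0 →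
      |z.im| ≤ 1 ∧ ∃ R : H →L[ℂ] H, IsResolvent A z R ∧ ‖R‖ ≤ B / |z.im| ^ q := by
  obtain ⟨L, hfin, ε, hε, hL⟩ := exists_approx_pos_of_typePiPlus hz
  obtain ⟨ρ, hρ, hball⟩ := Metric.isOpen_iff.1 hU s hsU
  set t : ℝ := min (ε / 4) (ρ / 2) with ht
  have ht0 : 0 < t := by positivity
  -- `t ≤ ε / 4` is what the dimension bound needs; `t ≤ ρ / 2` keeps `μ` in `U`.
  have htε : 4 * t ≤ ε := by
    have := min_le_left (ε / 4) (ρ / 2)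
    linarith
  have hμU : (s + t * Complex.I : ℂ) ∈ U := by
    refine hball ?_
    have := min_le_right (ε / 4) (ρ / 2)
    rw [mem_ball_iff_norm]
    simp [abs_of_pos ht0]
    linarith
  obtain ⟨R, hR⟩ := hUρ ⟨hμU, by simp [realLine, ht0.ne']⟩
  obtain ⟨M, hM, C, δ, hC, hδ, hco⟩ := exists_coercive_rootSpace (R := R) (s := s) hG ht0 htε
    (L := L) (fun h hh hle => by
      rw [← hR.pencil_eq] at hle
      exact hL ⟨R h, (hR.1 h).1⟩ hh hle)
  obtain ⟨r, B, q, hr, hB, hbound⟩ :=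
    pencil_lower_bound hG ht0 (hR.pencilSymmetric hsymm) hM hC hδ hco
  refine ⟨min (min r ρ) 1, ‖R‖ * B + 1, q, by positivity, by positivity, fun z hzr him => ?_⟩
  have hz1 : ‖z - s‖ < 1 := hzr.trans_le (min_le_right _ _)
  have hzr' : ‖z - s‖ < r := hzr.trans_le ((min_le_left _ _).trans (min_le_left _ _))
  have hzρ : ‖z - s‖ < ρ := hzr.trans_le ((min_le_left _ _).trans (min_le_right _ _))
  have hy : |z.im| ≤ 1 := by
    have := Complex.abs_im_le_norm (z - s)
    simp only [Complex.sub_im, Complex.ofReal_im, sub_zero] at this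
    linarith
  obtain ⟨S, hS⟩ := hUρ ⟨hball (mem_ball_iff_norm.2 hzρ), him⟩
  have hpos : 0 < |z.im| ^ q := pow_pos (abs_pos.2 him) q
  refine ⟨hy, S, hS, S.opNorm_le_bound (by positivity) fun u => ?_⟩
  obtain ⟨hd, hu⟩ := hS.1 u
  -- With `h = (A - μ) S u` one has `R h = S u` and `S_z h = u`, so the lower bound for the pencil
  -- bounds the resolvent `S`.
  set h : H := A ⟨S u, hd⟩ - (s + t * Complex.I : ℂ) • S u with hh
  have hRh : R h = S u := hR.2 ⟨S u, hd⟩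
  have hpen : pencil R (s + t * Complex.I) z h = u := by
    rw [← hR.pencil_eq]
    simpa only [hRh] using hu
  have h1 := hbound z hzr' him h
  rw [hpen] at h1
  rw [div_mul_eq_mul_div, le_div_iff₀ hpos, ← hRh]
  calc ‖R h‖ * |z.im| ^ q ≤ ‖R‖ * ‖h‖ * |z.im| ^ q := by gcongr; exact R.le_opNorm h
    _ = ‖R‖ * (|z.im| ^ q * ‖h‖) := by ring
    _ ≤ ‖R‖ * (B * ‖u‖) := by gcongr
    _ ≤ _ := by nlinarith [norm_nonneg u]

theorem resolvent_growth_of_typePiPlus [CompleteSpace H] {G : H →L[ℂ] H} (hG : IsSelfAdjoint G)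
    {A : H →ₗ.[ℂ] H} (hsymm : GSymmetric G A) {a b : ℝ}
    (hpi : realInterval a b ∩ approxSpectrum A ⊆ typePiPlus G A)
    {U : Set ℂ} (hU : IsOpen U) (hIU : realInterval a b ⊆ U)
    (hUρ : U \ realLine ⊆ resolventSet A) :
    ∃ (V : Set ℂ) (M : ℝ) (m : ℕ), IsOpen V ∧ realInterval a b ⊆ V ∧ 0 < M ∧
      ∀ z ∈ V \ realLine, ∃ R : H →L[ℂ] H, IsResolvent A z R ∧ ‖R‖ ≤ M / |z.im| ^ m := by
  suffices h : ∃ (V : Set ℂ) (M : ℝ) (m : ℕ), IsOpen V ∧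
      (fun x : ℝ => (x : ℂ)) '' Set.Icc a b ⊆ V ∧ 0 < M ∧ ∀ z ∈ V, z.im ≠ 0 →
      |z.im| ≤ 1 ∧ ∃ R : H →L[ℂ] H, IsResolvent A z R ∧ ‖R‖ ≤ M / |z.im| ^ m by
    obtain ⟨V, M, m, hV, hIV, hM, hR⟩ := h
    exact ⟨V, M, m, hV, hIV, hM, fun z hz => (hR z hz.1 hz.2).2⟩
  -- The bound `|Im z| ≤ 1` is carried along so that exponents may be increased when neighbourhoods
  -- are united.
  refine (isCompact_Icc (a := a) (b := b)).induction_on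
    (p := fun S => ∃ (V : Set ℂ) (M : ℝ) (m : ℕ), IsOpen V ∧
      (fun x : ℝ => (x : ℂ)) '' S ⊆ V ∧ 0 < M ∧ ∀ z ∈ V, z.im ≠ 0 →
      |z.im| ≤ 1 ∧ ∃ R : H →L[ℂ] H, IsResolvent A z R ∧ ‖R‖ ≤ M / |z.im| ^ m) ?_ ?_ ?_ ?_
  · exact ⟨∅, 1, 0, isOpen_empty, by simp, one_pos, by simp⟩
  · rintro S S' hSS' ⟨V, M, m, hV, hSV, hM, hR⟩
    exact ⟨V, M, m, hV, (Set.image_mono hSS').trans hSV, hM, hR⟩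
  · rintro S S' ⟨V, M, m, hV, hSV, hM, hR⟩ ⟨V', M', m', hV', hSV', hM', hR'⟩
    refine ⟨V ∪ V', M + M', m + m', hV.union hV', ?_, by positivity, fun z hz him => ?_⟩
    · rw [Set.image_union]
      exact Set.union_subset_union hSV hSV'
    · have hy : 0 < |z.im| := abs_pos.2 him
      rcases hz with hz | hz
      · obtain ⟨h1, R, hres, hn⟩ := hR z hz him
        refine ⟨h1, R, hres, hn.trans ?_⟩
        exact div_le_div₀ (by positivity) (by linarith) (by positivity)
          (pow_le_pow_of_le_one hy.le h1 (by omega))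
      · obtain ⟨h1, R, hres, hn⟩ := hR' z hz him
        refine ⟨h1, R, hres, hn.trans ?_⟩
        exact div_le_div₀ (by positivity) (by linarith) (by positivity)
          (pow_le_pow_of_le_one hy.le h1 (by omega))
  · intro s hs
    have hsI : (s : ℂ) ∈ realInterval a b := ⟨s, hs, rfl⟩
    obtain ⟨r, B, q, hr, hB, hR⟩ := resolvent_growth_near hG hsymm (s := s)
      (fun hap => hpi ⟨hsI, hap⟩) hU (hIU hsI) hUρ
    refine ⟨Metric.ball s r, mem_nhdsWithin_of_mem_nhds (Metric.ball_mem_nhds s hr),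
      Metric.ball (s : ℂ) r, B, q, Metric.isOpen_ball, ?_, hB,
      fun z hz => hR z (mem_ball_iff_norm.1 hz)⟩
    rintro _ ⟨x, hx, rfl⟩
    rw [Metric.mem_ball, Real.dist_eq] at hx
    rw [mem_ball_iff_norm, ← Complex.ofReal_sub, Complex.norm_real]
    exact hx

end Resolvent
end IndefSpec

theorem theorem4p7 {H : Type*} [NormedAddCommGroup H] [InnerProductSpace ℂ H] [CompleteSpace H]
    (G : H →L[ℂ] H) (hG : IsSelfAdjoint G)
    (A : H →ₗ.[ℂ] H) (hA : A.IsClosed) (hdense : Dense (A.domain : Set H))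
    (hsymm : IndefSpec.GSymmetric G A)
    (a b : ℝ) (hab : a ≤ b)
    (hpi : IndefSpec.realInterval a b ∩ IndefSpec.approxSpectrum A ⊆ IndefSpec.typePiPlus G A ∨
      IndefSpec.realInterval a b ∩ IndefSpec.approxSpectrum A ⊆ IndefSpec.typePiMinus G A)
    (hU : ∃ U : Set ℂ, IsOpen U ∧ IndefSpec.realInterval a b ⊆ U ∧
      U \ IndefSpec.realLine ⊆ IndefSpec.resolventSet A) :
    ∃ (V : Set ℂ) (M : ℝ) (m : ℕ), IsOpen V ∧ IndefSpec.realInterval a b ⊆ V ∧ 0 < M ∧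
      ∀ z ∈ V \ IndefSpec.realLine, ∃ R : H →L[ℂ] H,
        IndefSpec.IsResolvent A z R ∧ ‖R‖ ≤ M / |z.im| ^ m := by
  obtain ⟨U, hUo, hIU, hUρ⟩ := hU
  rcases hpi with hpi | hpi
  · exact IndefSpec.resolvent_growth_of_typePiPlus hG hsymm hpi hUo hIU hUρ
  · refine IndefSpec.resolvent_growth_of_typePiPlus hG.neg (fun x y => ?_)
      (hpi.trans (IndefSpec.typePiMinus_subset G A)) hUo hIU hUρ
    have := hsymm x y
    simp only [IndefSpec.gram, neg_apply, inner_neg_right] at this ⊢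
    rw [this]
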